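/- Let $n\ge 1$, let $D\subset\mathbb{R}^{n-1}$ be an open set, and let $\Omega=D\times(0,1)$, with points $x=(x',x_n)$, $x'\in D$, $x_n\in(0,1)$. Let $g\in W^{1,2}(\Omega)$ have constant traces on the two flat faces: $g=\alpha$ on $D\times\{0\}$ and $g=\beta$ on $D\times\{1\}$, where $\alpha,\beta\in\mathbb{R}$. For $u\in W^{1,2}(\Omega)$ put $$v(x')=\int_0^1u(x',x_n)\,dx_n,\qquad J(u)=\int_\Omega|\nabla u|^2\,dx+2\int_D v^+\,dx'\in[0,\infty].$$ Let $u$ be a minimizer of $J$ among the functions in $g+W^{1,2}_0(\Omega)$, with $J(u)<\infty$ (this finiteness is automatic if $D$ is bounded). Then $$u\in W^{2,2}(D'\times(0,1))\qquad\text{for every open } D'\Subset D,$$ where $D'\Subset D$ means that the closure $\overline{D'}$ is compact and contained in $D$. -/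

import Mathlib

open MeasureTheory Set Filter Topology
open scoped ENNReal ContDiff

noncomputable section

/-- The space `ℝ^m × ℝ` of points `x = (x', x_n)`, where `m = n - 1`. It carries the product
Lebesgue measure. -/
abbrev CylSpace (m : ℕ) : Type := EuclideanSpace ℝ (Fin m) × ℝ

/-- The coordinate directions `e_1, …, e_{n-1}, e_n` of `ℝ^m × ℝ`, the last one being the
direction of the axis of the cylinder. -/
def coordVec (m : ℕ) : Fin (m + 1) → CylSpace m :=
  Fin.lastCases ((0 : EuclideanSpace ℝ (Fin m)), (1 : ℝ))
    (fun i : Fin m => (EuclideanSpace.single i (1 : ℝ), (0 : ℝ)))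

/-- The cylinder `Ω = D × (0,1)`. -/
def barrel {m : ℕ} (D : Set (EuclideanSpace ℝ (Fin m))) : Set (CylSpace m) :=
  D ×ˢ Ioo (0 : ℝ) 1

/-- `φ ∈ C_0^∞(Ω)`. -/
def IsTestFun {m : ℕ} (Ω : Set (CylSpace m)) (φ : CylSpace m → ℝ) : Prop :=
  ContDiff ℝ ∞ φ ∧ HasCompactSupport φ ∧ tsupport φ ⊆ Ω

/-- `w` is the weak partial derivative `∂u/∂x_i` in `Ω`. This is only used for `u` and `w` in
`L²(Ω)`, where both integrals converge. -/
def HasWeakPartial {m : ℕ} (Ω : Set (CylSpace m)) (i : Fin (m + 1))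
    (u w : CylSpace m → ℝ) : Prop :=
  ∀ φ : CylSpace m → ℝ, IsTestFun Ω φ →
    ∫ x in Ω, u x * fderiv ℝ φ x (coordVec m i) = - ∫ x in Ω, w x * φ x

/-- `u ∈ W^{k,2}(Ω)`: `u ∈ L²(Ω)`, and, if `k ≥ 1`, every first order weak partial derivative of
`u` exists and belongs to `W^{k-1,2}(Ω)`. -/
def MemW {m : ℕ} (Ω : Set (CylSpace m)) : ℕ → (CylSpace m → ℝ) → Prop
  | 0, u => MemLp u 2 (volume.restrict Ω)
  | k + 1, u => MemLp u 2 (volume.restrict Ω) ∧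
      ∀ i : Fin (m + 1), ∃ w : CylSpace m → ℝ, MemW Ω k w ∧ HasWeakPartial Ω i u w

open Classical in
/-- The weak partial derivative `∂u/∂x_i ∈ L²(Ω)` (determined almost everywhere in `Ω` when `Ω` is
open; the value is `0` if there is none). -/
def weakPartial {m : ℕ} (Ω : Set (CylSpace m)) (i : Fin (m + 1)) (u : CylSpace m → ℝ) :
    CylSpace m → ℝ :=
  if h : ∃ w : CylSpace m → ℝ, MemLp w 2 (volume.restrict Ω) ∧ HasWeakPartial Ω i u w
  then h.choose else 0

/-- `u ∈ W^{1,2}_0(Ω)`, the closure of `C_0^∞(Ω)` in `W^{1,2}(Ω)`. -/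
def MemW0 {m : ℕ} (Ω : Set (CylSpace m)) (u : CylSpace m → ℝ) : Prop :=
  MemW Ω 1 u ∧ ∀ ε : ℝ≥0∞, 0 < ε → ∃ φ : CylSpace m → ℝ, IsTestFun Ω φ ∧
    eLpNorm (fun x => u x - φ x) 2 (volume.restrict Ω) < ε ∧
    ∀ i : Fin (m + 1),
      eLpNorm (fun x => weakPartial Ω i u x - fderiv ℝ φ x (coordVec m i)) 2
        (volume.restrict Ω) < ε

/-- `v(x') = ∫_0^1 u(x', t) dt`. -/
def axisMean {m : ℕ} (u : CylSpace m → ℝ) (x' : EuclideanSpace ℝ (Fin m)) : ℝ :=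
  ∫ t in Ioo (0 : ℝ) 1, u (x', t)

/-- The functional `J(u) = ∫_Ω |∇u|² dx + 2 ∫_D v⁺ dx'`, with values in `[0, ∞]`. -/
def obstacleJ {m : ℕ} (D : Set (EuclideanSpace ℝ (Fin m))) (u : CylSpace m → ℝ) : ℝ≥0∞ :=
  (∫⁻ x in barrel D, ENNReal.ofReal (∑ i, weakPartial (barrel D) i u x ^ 2)) +
    2 * ∫⁻ x' in D, ENNReal.ofReal (max (axisMean u x') 0)

/-- `u` minimizes `J` in the class `g + W^{1,2}_0(Ω)`, the minimum being finite. Finiteness is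
automatic when `D` has finite measure, because then `J < ∞` on all of `W^{1,2}(Ω)`. -/
def IsMinimizerJ {m : ℕ} (D : Set (EuclideanSpace ℝ (Fin m))) (g u : CylSpace m → ℝ) : Prop :=
  MemW (barrel D) 1 u ∧ MemW0 (barrel D) (fun x => u x - g x) ∧ obstacleJ D u ≠ ⊤ ∧
    ∀ w : CylSpace m → ℝ, MemW (barrel D) 1 w →
      MemW0 (barrel D) (fun x => w x - g x) → obstacleJ D u ≤ obstacleJ D w

/-- The function `g` on `D × (0,1)` has the trace `τ` on the flat face `D × {0}`: the mean of
`‖g(·, t) - τ‖²` (norm of `L²(D)`) over `0 < t < δ` tends to `0` as `δ → 0⁺`. -/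
def HasBottomTrace {m : ℕ} (D : Set (EuclideanSpace ℝ (Fin m))) (g : CylSpace m → ℝ)
    (τ : EuclideanSpace ℝ (Fin m) → ℝ) : Prop :=
  Tendsto (fun δ : ℝ => (ENNReal.ofReal δ)⁻¹ *
      ∫⁻ x in D ×ˢ Ioo (0 : ℝ) δ, ENNReal.ofReal ((g x - τ x.1) ^ 2))
    (𝓝[>] (0 : ℝ)) (𝓝 0)

/-- The function `g` on `D × (0,1)` has the trace `τ` on the flat face `D × {1}`. -/
def HasTopTrace {m : ℕ} (D : Set (EuclideanSpace ℝ (Fin m))) (g : CylSpace m → ℝ)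
    (τ : EuclideanSpace ℝ (Fin m) → ℝ) : Prop :=
  Tendsto (fun δ : ℝ => (ENNReal.ofReal δ)⁻¹ *
      ∫⁻ x in D ×ˢ Ioo (1 - δ) (1 : ℝ), ENNReal.ofReal ((g x - τ x.1) ^ 2))
    (𝓝[>] (0 : ℝ)) (𝓝 0)

end

noncomputable section

/-! The penalty term is Lipschitz for the `L¹` norm, so comparing a minimizer `u` with `u + tφ` and
letting `t → 0±` gives `|∫ ∇u·∇φ| ≤ ∫ |φ|` for test functions (`IsMinimizerJ.abs_sum_integral_le`).
No exact Euler–Lagrange equation is needed: on a subcylinder of finite measure the right side is at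
most a constant times `‖φ‖₂`, so by Riesz `Δu = f` there with `f` in `L²`
(`IsMinimizerJ.exists_weak_laplacian`).

Regularity up to the flat faces comes from reflection. Let `G` be a smooth function of `x_n` alone,
equal to `α` near `0` and to `β` near `1`. Then `u - G = (u - g) + (g - G)` has zero trace on both
faces, the first summand because it lies in `W^{1,2}_0`, the second by the trace hypotheses. Hence
it can be integrated by parts against test functions that do not vanish there
(`IsMinimizerJ.integral_sub_mul_pd`). Extended by zero to a function `U` and replaced by `U(x',t) -
U(x',-t) - U(x',2-t)`, it solves a Poisson equation with `L²` right side across both faces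
(`exists_sq_integral_mul_pd_pd_le_of_cylinder`).

What remains is an interior estimate. Multiplication by a cutoff gives a compactly supported `W`
whose distributional Laplacian `F` is in `L²`. After mollification, `∑ ∫ |∂ᵢ∂ⱼw|² = ∫ (Δw)²` bounds
the second derivatives by `‖F‖₂`, uniformly in the mollifier (`sq_integral_mul_pd_pd_le`). All
second order bounds are kept in the dual form `(∫ U ∂ᵢ∂ⱼφ)² ≤ C ∫ φ²`, which passes through
reflection and localization and is turned into genuine weak derivatives only at the end, by Riesz
representation. -/

instance instIsAddHaarMeasureCylSpace (m : ℕ) :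
    (volume : Measure (CylSpace m)).IsAddHaarMeasure :=
  inferInstanceAs
    ((volume : Measure (EuclideanSpace ℝ (Fin m))).prod (volume : Measure ℝ)).IsAddHaarMeasure

/-- The partial derivative in the `i`-th coordinate direction. -/
def pd {m : ℕ} (i : Fin (m + 1)) (φ : CylSpace m → ℝ) : CylSpace m → ℝ :=
  fun x => fderiv ℝ φ x (coordVec m i)

/-- The Laplacian. -/
def lap {m : ℕ} (φ : CylSpace m → ℝ) : CylSpace m → ℝ :=
  fun x => ∑ i, pd i (pd i φ) x

/-! ### Test functions, integration by parts, and the second order energy identity. -/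

section Calculus

variable {m : ℕ} {Ω Ω' : Set (CylSpace m)} {f g φ ψ : CylSpace m → ℝ} {i j : Fin (m + 1)}

theorem ContDiff.pd (hf : ContDiff ℝ ∞ f) (i : Fin (m + 1)) : ContDiff ℝ ∞ (pd i f) :=
  (hf.fderiv_right (m := ∞) (by simp)).clm_apply contDiff_const

theorem ContDiff.lap (hf : ContDiff ℝ ∞ f) : ContDiff ℝ ∞ (lap f) :=
  ContDiff.sum fun i _ => (hf.pd i).pd i

theorem ContDiff.diff (hf : ContDiff ℝ ∞ f) : Differentiable ℝ f :=
  hf.differentiable (by simp)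

theorem pd_mul (hf : ContDiff ℝ ∞ f) (hg : ContDiff ℝ ∞ g) (x : CylSpace m) :
    pd i (fun y => f y * g y) x = f x * pd i g x + pd i f x * g x := by
  unfold pd
  rw [fderiv_fun_mul (hf.diff x) (hg.diff x)]
  simp [mul_comm]

theorem pd_add (hf : ContDiff ℝ ∞ f) (hg : ContDiff ℝ ∞ g) (x : CylSpace m) :
    pd i (fun y => f y + g y) x = pd i f x + pd i g x := by
  unfold pd
  rw [fderiv_fun_add (hf.diff x) (hg.diff x)]
  simp

theorem pd_const_mul (hf : ContDiff ℝ ∞ f) (c : ℝ) (x : CylSpace m) :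
    pd i (fun y => c * f y) x = c * pd i f x := by
  unfold pd
  rw [fderiv_const_mul (hf.diff x)]
  simp

theorem pd_comm (hf : ContDiff ℝ ∞ f) : pd i (pd j f) = pd j (pd i f) := by
  funext x
  have h : IsSymmSndFDerivAt ℝ f x :=
    (hf.contDiffAt).isSymmSndFDerivAt (by simp; exact WithTop.coe_le_coe.2 (le_top : (2 : ℕ∞) ≤ ⊤))
  have hd : DifferentiableAt ℝ (fderiv ℝ f) x :=
    (hf.fderiv_right (m := ∞) (by simp)).differentiable (by simp) x
  have key : ∀ k l : Fin (m + 1), pd k (pd l f) x =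
      fderiv ℝ (fderiv ℝ f) x (coordVec m k) (coordVec m l) := by
    intro k l
    unfold pd
    rw [fderiv_clm_apply hd (differentiableAt_const _)]
    simp
  rw [key, key]
  exact h _ _

namespace IsTestFun

theorem mono (hφ : IsTestFun Ω φ) (h : Ω ⊆ Ω') : IsTestFun Ω' φ :=
  ⟨hφ.1, hφ.2.1, hφ.2.2.trans h⟩

theorem to_univ (hφ : IsTestFun Ω φ) : IsTestFun Set.univ φ := hφ.mono (subset_univ _)

theorem pd (hφ : IsTestFun Ω φ) (i : Fin (m + 1)) : IsTestFun Ω (pd i φ) :=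
  ⟨hφ.1.pd i, hφ.2.1.fderiv_apply ℝ _, (tsupport_fderiv_apply_subset ℝ _).trans hφ.2.2⟩

theorem mul_left (hφ : IsTestFun Ω φ) (hf : ContDiff ℝ ∞ f) :
    IsTestFun Ω (fun x => f x * φ x) :=
  ⟨hf.mul hφ.1, hφ.2.1.mul_left, (tsupport_mul_subset_right).trans hφ.2.2⟩

theorem mul_right (hφ : IsTestFun Ω φ) (hf : ContDiff ℝ ∞ f) :
    IsTestFun Ω (fun x => φ x * f x) :=
  ⟨hφ.1.mul hf, hφ.2.1.mul_right, (tsupport_mul_subset_left).trans hφ.2.2⟩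

theorem add (hφ : IsTestFun Ω φ) (hψ : IsTestFun Ω ψ) : IsTestFun Ω (fun x => φ x + ψ x) :=
  ⟨hφ.1.add hψ.1, hφ.2.1.add hψ.2.1,
    (tsupport_add φ ψ).trans (union_subset hφ.2.2 hψ.2.2)⟩

theorem const_mul (hφ : IsTestFun Ω φ) (c : ℝ) : IsTestFun Ω (fun x => c * φ x) :=
  hφ.mul_left contDiff_const

theorem zero : IsTestFun Ω (0 : CylSpace m → ℝ) :=
  ⟨contDiff_const, HasCompactSupport.zero, by simp⟩

theorem lap (hφ : IsTestFun Ω φ) : IsTestFun Ω (lap φ) := by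
  unfold _root_.lap
  refine ⟨hφ.1.lap, ?_, ?_⟩
  · exact HasCompactSupport.intro hφ.2.1 fun x hx => Finset.sum_eq_zero fun i _ =>
      image_eq_zero_of_notMem_tsupport
        fun h => hx ((tsupport_fderiv_apply_subset ℝ _).trans
          (tsupport_fderiv_apply_subset ℝ _) h)
  · refine (closure_minimal ?_ (isClosed_tsupport φ)).trans hφ.2.2
    intro x hx
    by_contra h
    exact hx (Finset.sum_eq_zero fun i _ =>
      image_eq_zero_of_notMem_tsupport
        fun h' => h ((tsupport_fderiv_apply_subset ℝ _).trans
          (tsupport_fderiv_apply_subset ℝ _) h'))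

theorem memLp (hφ : IsTestFun Ω φ) (p : ℝ≥0∞) : MemLp φ p volume :=
  hφ.1.continuous.memLp_of_hasCompactSupport hφ.2.1

theorem integrable (hφ : IsTestFun Ω φ) : Integrable φ volume :=
  hφ.1.continuous.integrable_of_hasCompactSupport hφ.2.1

theorem bdd (hφ : IsTestFun Ω φ) : ∃ C, ∀ x, ‖φ x‖ ≤ C :=
  hφ.1.continuous.bounded_above_of_compact_support hφ.2.1

end IsTestFun

theorem integral_mul_pd (hf : ContDiff ℝ ∞ f) (hφ : IsTestFun Ω φ) :
    ∫ x, f x * pd i φ x = - ∫ x, pd i f x * φ x := by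
  refine integral_mul_fderiv_eq_neg_fderiv_mul_of_integrable ?_ ?_ ?_
    (fun x _ => hf.diff x) (fun x _ => hφ.1.diff x)
  · exact (hφ.mul_left (hf.pd i)).integrable
  · exact ((hφ.pd i).mul_left hf).integrable
  · exact (hφ.mul_left hf).integrable

/-- Integrating either side by parts once, in direction `i` on the left and `j` on the right, gives
the same third order integral because derivatives commute. -/
theorem integral_pd_mul_pd (hφ : IsTestFun Ω φ) (i j : Fin (m + 1)) :
    ∫ x, pd i (pd j φ) x * pd i (pd j φ) x = ∫ x, pd i (pd i φ) x * pd j (pd j φ) x := by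
  have h1 := integral_mul_pd (i := i) ((hφ.pd j).pd i).1 (hφ.pd j)
  have h2 := integral_mul_pd (i := j) ((hφ.pd i).pd i).1 (hφ.pd j)
  rw [h1, h2, pd_comm (i := j) (hφ.pd i).1 (j := i), pd_comm (i := j) hφ.1 (j := i)]

/-- Expanding the square of the Laplacian and applying `integral_pd_mul_pd` to each product shows
that `∫ (Δφ)²` is the sum of the integrals of all squared second derivatives; the bound keeps one
term. -/
theorem integral_sq_pd_pd_le (hφ : IsTestFun Ω φ) (i j : Fin (m + 1)) :
    ∫ x, pd i (pd j φ) x ^ 2 ≤ ∫ x, lap φ x ^ 2 := by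
  have hint : ∀ i j k l : Fin (m + 1),
      Integrable (fun x => pd i (pd j φ) x * pd k (pd l φ) x) volume := fun i j k l =>
    (((hφ.pd j).pd i).mul_right ((hφ.pd l).pd k).1).integrable
  have h : ∫ x, lap φ x ^ 2 = ∑ i, ∑ j, ∫ x, pd i (pd j φ) x ^ 2 := by
    have : ∀ x, lap φ x ^ 2 = ∑ i, ∑ j, pd i (pd i φ) x * pd j (pd j φ) x := by
      intro x
      rw [sq, lap, Finset.sum_mul_sum]
    simp_rw [this]
    rw [integral_finsetSum _ fun i _ => integrable_finsetSum _ fun j _ => hint i i j j]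
    refine Finset.sum_congr rfl fun i _ => ?_
    rw [integral_finsetSum _ fun j _ => hint i i j j]
    refine Finset.sum_congr rfl fun j _ => ?_
    rw [← integral_pd_mul_pd hφ]
    simp_rw [sq]
  rw [h]
  have hnn : ∀ i j, 0 ≤ ∫ x, pd i (pd j φ) x ^ 2 := fun i j =>
    integral_nonneg fun x => sq_nonneg _
  exact (Finset.single_le_sum (f := fun j => ∫ x, pd i (pd j φ) x ^ 2)
    (fun j _ => hnn i j) (Finset.mem_univ j)).trans
    (Finset.single_le_sum (f := fun i => ∑ j, ∫ x, pd i (pd j φ) x ^ 2)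
      (fun i _ => Finset.sum_nonneg fun j _ => hnn i j) (Finset.mem_univ i))

end Calculus

/-! ### Cauchy–Schwarz and Riesz representation in `L²`. -/

section Hilbert

variable {α : Type*} [MeasurableSpace α] {μ : Measure α} {f g : α → ℝ}

theorem inner_toLp (hf : MemLp f 2 μ) (hg : MemLp g 2 μ) :
    inner ℝ (hf.toLp f) (hg.toLp g) = ∫ x, f x * g x ∂μ := by
  rw [L2.inner_def]
  refine integral_congr_ae ?_
  filter_upwards [hf.coeFn_toLp, hg.coeFn_toLp] with x h1 h2
  rw [h1, h2]
  simp [mul_comm]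

theorem sq_integral_mul_le (hf : MemLp f 2 μ) (hg : MemLp g 2 μ) :
    (∫ x, f x * g x ∂μ) ^ 2 ≤ (∫ x, f x ^ 2 ∂μ) * ∫ x, g x ^ 2 ∂μ := by
  have := real_inner_mul_inner_self_le (hf.toLp f) (hg.toLp g)
  rw [inner_toLp, inner_toLp, inner_toLp] at this
  simpa only [sq] using this

/-- The bound makes `L` vanish on the kernel of `ι`, so `L` descends to a bounded functional on the
range. Hahn–Banach extends it to `H`, where the Riesz theorem applies; density of the range is not
required. -/
theorem exists_inner_of_sq_le {T H : Type*} [AddCommGroup T] [Module ℝ T]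
    [NormedAddCommGroup H] [InnerProductSpace ℝ H] [CompleteSpace H]
    (ι : T →ₗ[ℝ] H) (L : T →ₗ[ℝ] ℝ) (C : ℝ) (hL : ∀ t, L t ^ 2 ≤ C * ‖ι t‖ ^ 2) :
    ∃ h : H, ∀ t, L t = inner ℝ h (ι t) := by
  obtain ⟨s, hs⟩ := ι.rangeRestrict.exists_rightInverse_of_surjective ι.range_rangeRestrict
  have hs' : ∀ y : ι.range, ι (s y) = y := fun y => congrArg Subtype.val (LinearMap.congr_fun hs y)
  have hbd : ∀ t, |L t| ≤ Real.sqrt (max C 0) * ‖ι t‖ := by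
    intro t
    rw [← Real.sqrt_sq_eq_abs]
    refine Real.sqrt_le_iff.2 ⟨by positivity, (hL t).trans ?_⟩
    rw [mul_pow, Real.sq_sqrt (le_max_right _ _)]
    gcongr
    exact le_max_left _ _
  let M : StrongDual ℝ ι.range :=
    (L.comp s).mkContinuous (Real.sqrt (max C 0)) fun y => by
      have := hbd (s y)
      rwa [hs'] at this
  obtain ⟨N, hN, -⟩ := exists_extension_norm_eq ι.range M
  refine ⟨(InnerProductSpace.toDual ℝ H).symm N, fun t => ?_⟩
  rw [InnerProductSpace.toDual_symm_apply]
  have h1 : N (ι t) = M ⟨ι t, t, rfl⟩ := hN ⟨ι t, t, rfl⟩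
  rw [h1]
  have h2 : M ⟨ι t, t, rfl⟩ = L (s ⟨ι t, t, rfl⟩) := rfl
  rw [h2, ← sub_eq_zero, ← map_sub]
  -- `t` and the chosen preimage of `ι t` differ by an element of the kernel of `ι`, on which the
  -- bound forces `L` to be zero.
  have h3 := hbd (t - s ⟨ι t, t, rfl⟩)
  rw [map_sub ι, hs', sub_self, norm_zero, mul_zero] at h3
  exact abs_nonpos_iff.1 h3

/-- The Riesz representation theorem for functionals on a space of square integrable functions. -/
theorem exists_memLp_of_sq_le (S : Submodule ℝ (α → ℝ)) (hS : ∀ φ ∈ S, MemLp φ 2 μ)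
    (L : S →ₗ[ℝ] ℝ) (C : ℝ) (hL : ∀ φ : S, L φ ^ 2 ≤ C * ∫ x, φ.1 x ^ 2 ∂μ) :
    ∃ f : α → ℝ, MemLp f 2 μ ∧ ∀ φ : S, L φ = ∫ x, f x * φ.1 x ∂μ := by
  let ι : S →ₗ[ℝ] Lp ℝ 2 μ :=
    { toFun := fun φ => (hS φ.1 φ.2).toLp φ.1
      map_add' := fun φ ψ => MemLp.toLp_add _ _
      map_smul' := fun c φ => MemLp.toLp_const_smul c _ }
  obtain ⟨h, hh⟩ := exists_inner_of_sq_le ι L C fun φ => by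
    rw [← real_inner_self_eq_norm_sq]
    have : inner ℝ (ι φ) (ι φ) = ∫ x, φ.1 x ^ 2 ∂μ := by
      simp_rw [sq]
      exact inner_toLp (hS φ.1 φ.2) (hS φ.1 φ.2)
    rw [this]
    exact hL φ
  refine ⟨h, Lp.memLp h, fun φ => ?_⟩
  rw [hh, ← inner_toLp (Lp.memLp h) (hS φ.1 φ.2), Lp.toLp_coeFn]
  rfl

end Hilbert

/-- The space of test functions in `Ω`. -/
def testSpace {m : ℕ} (Ω : Set (CylSpace m)) : Submodule ℝ (CylSpace m → ℝ) where
  carrier := {φ | IsTestFun Ω φ}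
  add_mem' h h' := IsTestFun.add h h'
  zero_mem' := IsTestFun.zero
  smul_mem' c _ h := IsTestFun.const_mul h c

/-- The mollification of `φ` by the normalized bump function `ρ`. -/
def moll {m : ℕ} (ρ : ContDiffBump (0 : CylSpace m)) (φ : CylSpace m → ℝ) : CylSpace m → ℝ :=
  convolution (ρ.normed volume) φ (ContinuousLinearMap.lsmul ℝ ℝ) volume

/-! ### Mollification and the global second derivative estimate. -/

section Moll

variable {m : ℕ} {φ W F : CylSpace m → ℝ} {i j : Fin (m + 1)}
  (ρ : ContDiffBump (0 : CylSpace m))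

theorem moll_apply (φ : CylSpace m → ℝ) (x : CylSpace m) :
    moll ρ φ x = ∫ t, ρ.normed volume t * φ (x - t) := by
  simp [moll, convolution_lsmul]

theorem moll_apply_swap (φ : CylSpace m → ℝ) (x : CylSpace m) :
    moll ρ φ x = ∫ y, ρ.normed volume (x - y) * φ y := by
  simp [moll, convolution_lsmul_swap]

theorem continuous_normed : Continuous (ρ.normed (volume : Measure (CylSpace m))) :=
  (ρ.contDiff_normed (n := 0)).continuous

theorem IsTestFun.mollify (hφ : IsTestFun univ φ) : IsTestFun univ (moll ρ φ) :=
  ⟨hφ.2.1.contDiff_convolution_right _ ρ.integrable_normed.locallyIntegrable hφ.1,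
    ρ.hasCompactSupport_normed.convolution _ hφ.2.1, subset_univ _⟩

/-- In contrast to `IsTestFun.mollify`, smoothness here comes from the kernel alone. -/
theorem isTestFun_moll (hW : LocallyIntegrable W volume) (hWc : HasCompactSupport W) :
    IsTestFun univ (moll ρ W) :=
  ⟨ρ.hasCompactSupport_normed.contDiff_convolution_left _ ρ.contDiff_normed hW,
    ρ.hasCompactSupport_normed.convolution _ hWc, subset_univ _⟩

theorem pd_moll (hφ : IsTestFun univ φ) (i : Fin (m + 1)) :
    pd i (moll ρ φ) = moll ρ (pd i φ) := by
  funext x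
  have hφ1 : ContDiff ℝ 1 φ := hφ.1.of_le (by exact_mod_cast le_top)
  have hρ : LocallyIntegrable (ρ.normed (volume : Measure (CylSpace m))) volume :=
    ρ.integrable_normed.locallyIntegrable
  have h := hφ.2.1.hasFDerivAt_convolution_right (ContinuousLinearMap.lsmul ℝ ℝ) hρ hφ1 x
  unfold pd moll
  rw [h.fderiv]
  exact convolution_precompR_apply _ hρ (hφ.2.1.fderiv ℝ) (hφ1.continuous_fderiv (by simp)) _ _

theorem integrable_normed_mul_comp_sub (hφ : IsTestFun univ φ) (x : CylSpace m) :
    Integrable (fun t => ρ.normed volume t * φ (x - t)) volume :=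
  (((continuous_normed ρ).mul (hφ.1.continuous.comp (by fun_prop)))).integrable_of_hasCompactSupport
    ρ.hasCompactSupport_normed.mul_right

theorem lap_moll (hφ : IsTestFun univ φ) : lap (moll ρ φ) = moll ρ (lap φ) := by
  funext x
  have h : ∀ i, pd i (pd i (moll ρ φ)) x = ∫ t, ρ.normed volume t * pd i (pd i φ) (x - t) :=
    fun i => by rw [pd_moll ρ hφ, pd_moll ρ (hφ.pd _), moll_apply]
  rw [moll_apply]
  simp only [lap, h]
  rw [← integral_finsetSum _ fun i _ =>
    integrable_normed_mul_comp_sub ρ ((hφ.pd i).pd i) x]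
  simp_rw [Finset.mul_sum]

theorem integral_sq_moll_le (hφ : IsTestFun univ φ) :
    ∫ x, moll ρ φ x ^ 2 ≤ ∫ x, φ x ^ 2 := by
  have hφ2 : IsTestFun univ (fun x => φ x ^ 2) := by
    simp_rw [sq]; exact hφ.mul_left hφ.1
  have hpt : ∀ x, moll ρ φ x ^ 2 ≤ moll ρ (fun y => φ y ^ 2) x := by
    intro x
    rw [moll_apply, moll_apply]
    -- Writing the kernel as `√ρ · √ρ` and using `∫ ρ = 1`, Cauchy–Schwarz yields the pointwise
    -- Jensen inequality `(ρ * φ)² ≤ ρ * φ²`.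
    have hs : Continuous fun t => √(ρ.normed volume t) := (continuous_normed ρ).sqrt
    have hsc : HasCompactSupport fun t => √(ρ.normed volume t) :=
      ρ.hasCompactSupport_normed.comp_left (g := Real.sqrt) Real.sqrt_zero
    have hss : ∀ t, √(ρ.normed volume t) * √(ρ.normed volume t) = ρ.normed volume t :=
      fun t => Real.mul_self_sqrt (ρ.nonneg_normed t)
    have hg : Continuous fun t => √(ρ.normed volume t) * φ (x - t) :=
      hs.mul (hφ.1.continuous.comp (by fun_prop))
    have := sq_integral_mul_le (hs.memLp_of_hasCompactSupport (μ := volume) (p := 2) hsc)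
      (hg.memLp_of_hasCompactSupport (μ := volume) (p := 2) hsc.mul_right)
    simp only [← mul_assoc, hss, mul_pow, sq √_, ρ.integral_normed, one_mul] at this
    exact this
  refine (integral_mono ?_ ?_ hpt).trans_eq ?_
  · have := (IsTestFun.mollify ρ hφ)
    simp_rw [sq]
    exact (this.mul_left this.1).integrable
  · exact (IsTestFun.mollify ρ hφ2).integrable
  · unfold moll
    rw [integral_convolution _ ρ.integrable_normed hφ2.integrable, ρ.integral_normed]
    simp

/-- The kernel is even, so mollification is self-adjoint by Fubini. -/
theorem integral_moll_mul (hW : Integrable W volume) (hφ : IsTestFun univ φ) :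
    ∫ x, moll ρ W x * φ x = ∫ x, W x * moll ρ φ x := by
  simp_rw [moll_apply_swap, ← integral_mul_const, ← integral_const_mul]
  rw [integral_integral_swap]
  · refine integral_congr_ae (ae_of_all _ fun y => integral_congr_ae (ae_of_all _ fun x => ?_))
    simp only
    rw [← neg_sub y x, ρ.normed_neg]
    ring
  · obtain ⟨C, hC⟩ := (continuous_normed ρ).bounded_above_of_compact_support
      ρ.hasCompactSupport_normed
    have := ((hφ.integrable.mul_prod hW).bdd_mul (c := C)
      (f := fun z : CylSpace m × CylSpace m => ρ.normed volume (z.1 - z.2))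
      ((continuous_normed ρ).comp (by fun_prop)).aestronglyMeasurable
      (ae_of_all _ fun z => hC _))
    refine this.congr (ae_of_all _ fun z => ?_)
    simp only [Function.uncurry]
    ring

theorem exists_moll_close (hφ : IsTestFun univ φ) {ε : ℝ} (hε : 0 < ε) :
    ∃ ρ : ContDiffBump (0 : CylSpace m), ∀ x, |moll ρ φ x - φ x| ≤ ε := by
  obtain ⟨δ, hδ, h⟩ := Metric.uniformContinuous_iff.1
    (hφ.2.1.uniformContinuous_of_continuous hφ.1.continuous) ε hε
  refine ⟨⟨δ / 2, δ, by positivity, by linarith⟩, fun x => ?_⟩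
  rw [← Real.dist_eq]
  exact ContDiffBump.dist_normed_convolution_le hφ.1.continuous.aestronglyMeasurable
    fun y hy => (h hy).le

theorem integral_mul_lap {f : CylSpace m → ℝ} (hf : ContDiff ℝ ∞ f) (hφ : IsTestFun univ φ) :
    ∫ x, f x * lap φ x = ∫ x, lap f x * φ x := by
  simp only [lap, Finset.mul_sum, Finset.sum_mul]
  rw [integral_finsetSum _ fun i _ => (((hφ.pd i).pd i).mul_left hf).integrable,
    integral_finsetSum _ fun i _ => (hφ.mul_left ((hf.pd i).pd i)).integrable]
  refine Finset.sum_congr rfl fun i _ => ?_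
  rw [integral_mul_pd hf (hφ.pd i), integral_mul_pd (hf.pd i) hφ, neg_neg]

/-- With `ψ = Δ(ρ * W)`, moving both the Laplacian and the mollifier to the other factor gives `‖ψ‖²
= ∫ F (ρ * ψ) ≤ ‖F‖ ‖ψ‖`, since mollification contracts `L²`. -/
theorem integral_sq_lap_moll_le (hW : Integrable W volume) (hWc : HasCompactSupport W)
    (hF : MemLp F 2 volume)
    (hWF : ∀ φ, IsTestFun univ φ → ∫ x, W x * lap φ x = ∫ x, F x * φ x) :
    ∫ x, lap (moll ρ W) x ^ 2 ≤ ∫ x, F x ^ 2 := by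
  have hw := isTestFun_moll ρ hW.locallyIntegrable hWc
  set ψ := lap (moll ρ W) with hψ
  have hψt : IsTestFun univ ψ := hw.lap
  have h1 : ∫ x, ψ x ^ 2 = ∫ x, F x * moll ρ ψ x := by
    simp_rw [sq]
    conv_lhs => enter [2, x, 1]; rw [hψ]
    rw [← integral_mul_lap hw.1 hψt, integral_moll_mul ρ hW hψt.lap, ← lap_moll ρ hψt,
      hWF _ (IsTestFun.mollify ρ hψt)]
  have h2 := sq_integral_mul_le hF ((IsTestFun.mollify ρ hψt).memLp 2)
  rw [← h1] at h2
  have h3 := integral_sq_moll_le ρ hψt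
  have hF0 : 0 ≤ ∫ x, F x ^ 2 := integral_nonneg fun x => sq_nonneg _
  have h0 : 0 ≤ ∫ x, ψ x ^ 2 := integral_nonneg fun x => sq_nonneg _
  by_contra! hlt
  nlinarith [mul_le_mul_of_nonneg_left h3 hF0]

/-- The `L²` bound for second derivatives of a compactly supported square integrable function
whose distributional Laplacian is square integrable. -/
theorem sq_integral_mul_pd_pd_le (hW : Integrable W volume) (hWc : HasCompactSupport W)
    (hF : MemLp F 2 volume)
    (hWF : ∀ φ, IsTestFun univ φ → ∫ x, W x * lap φ x = ∫ x, F x * φ x)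
    (hφ : IsTestFun univ φ) (i j : Fin (m + 1)) :
    (∫ x, W x * pd i (pd j φ) x) ^ 2 ≤ (∫ x, F x ^ 2) * ∫ x, φ x ^ 2 := by
  set A := (∫ x, F x ^ 2) * ∫ x, φ x ^ 2 with hA
  have hA0 : 0 ≤ A := mul_nonneg (integral_nonneg fun x => sq_nonneg _)
    (integral_nonneg fun x => sq_nonneg _)
  have hψ := (hφ.pd j).pd i
  have hmoll : ∀ ρ : ContDiffBump (0 : CylSpace m),
      |∫ x, W x * moll ρ (pd i (pd j φ)) x| ≤ √A := by
    intro ρ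
    have hw := isTestFun_moll ρ hW.locallyIntegrable hWc
    apply Real.abs_le_sqrt
    rw [← integral_moll_mul ρ hW hψ, integral_mul_pd hw.1 (hφ.pd j),
      integral_mul_pd (hw.pd i).1 hφ, neg_neg]
    refine (sq_integral_mul_le (((hw.pd i).pd j).memLp 2) (hφ.memLp 2)).trans ?_
    refine mul_le_mul_of_nonneg_right ?_ (integral_nonneg fun x => sq_nonneg _)
    exact (integral_sq_pd_pd_le hw j i).trans (integral_sq_lap_moll_le ρ hW hWc hF hWF)
  -- The mollifier is removed on the smooth factor: `ρ * ∂ᵢ∂ⱼφ` approximates `∂ᵢ∂ⱼφ` uniformly and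
  -- `W` is integrable. The tolerance has `N + 1` in the denominator to allow `N = 0`.
  have hbound : |∫ x, W x * pd i (pd j φ) x| ≤ √A := by
    refine le_of_forall_pos_le_add fun ε hε => ?_
    set N := ∫ x, |W x| with hN
    have hN0 : 0 ≤ N := integral_nonneg fun x => abs_nonneg _
    obtain ⟨ρ, hρ⟩ := exists_moll_close hψ (ε := ε / (N + 1)) (by positivity)
    have hint : ∀ χ, IsTestFun univ χ → Integrable (fun x => W x * χ x) volume := by
      intro χ hχ
      obtain ⟨C, hC⟩ := hχ.bdd
      exact hW.mul_bdd hχ.1.continuous.aestronglyMeasurable (ae_of_all _ hC)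
    have hd : |(∫ x, W x * moll ρ (pd i (pd j φ)) x) - ∫ x, W x * pd i (pd j φ) x| ≤ ε := by
      rw [← integral_sub (hint _ (IsTestFun.mollify ρ hψ)) (hint _ hψ)]
      refine (abs_integral_le_integral_abs).trans ?_
      have : ∫ x, |W x * moll ρ (pd i (pd j φ)) x - W x * pd i (pd j φ) x|
          ≤ ∫ x, |W x| * (ε / (N + 1)) := by
        refine integral_mono ((hint _ (IsTestFun.mollify ρ hψ)).sub (hint _ hψ)).abs
          (hW.abs.mul_const _) fun x => ?_
        simp only
        rw [← mul_sub, abs_mul]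
        gcongr
        exact hρ x
      refine this.trans ?_
      rw [integral_mul_const, ← hN, ← mul_div_assoc, div_le_iff₀ (by positivity)]
      nlinarith
    have := hmoll ρ
    rw [abs_le] at *
    constructor <;> linarith [hd.1, hd.2, this.1, this.2]
  calc _ = |∫ x, W x * pd i (pd j φ) x| ^ 2 := (sq_abs _).symm
    _ ≤ √A ^ 2 := by gcongr
    _ = A := Real.sq_sqrt hA0

end Moll

/-! ### Localization by a cutoff: the interior estimate. -/

section Interior

variable {m : ℕ} {O : Set (CylSpace m)} {V f η φ : CylSpace m → ℝ}
  {G : Fin (m + 1) → CylSpace m → ℝ}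

theorem IsTestFun.integrable_mul (hφ : IsTestFun O φ) (hf : MemLp f 2 volume) :
    Integrable (fun x => f x * φ x) volume :=
  hf.integrable_mul (hφ.memLp 2)

theorem IsTestFun.memLp_mul (hφ : IsTestFun O φ) (hf : MemLp f 2 volume) :
    MemLp (fun x => f x * φ x) 2 volume := by
  obtain ⟨C, hC⟩ := hφ.bdd
  refine hf.of_le_mul (c := C) (hf.1.mul hφ.1.continuous.aestronglyMeasurable)
    (ae_of_all _ fun x => ?_)
  rw [norm_mul, mul_comm]
  gcongr
  exact hC x

/-- This is `Δ(Vη) = ηf + 2∇V·∇η + VΔη` in the sense of distributions, with `G = ∇V` and `ΔV = f` in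
`O`. -/
theorem integral_mul_lap_localized (hV : MemLp V 2 volume) (hG : ∀ i, MemLp (G i) 2 volume)
    (hf : MemLp f 2 volume)
    (hVG : ∀ i φ, IsTestFun O φ → ∫ x, V x * pd i φ x = - ∫ x, G i x * φ x)
    (hGf : ∀ φ, IsTestFun O φ → ∑ i, ∫ x, G i x * pd i φ x = - ∫ x, f x * φ x)
    (hη : IsTestFun O η) (hφ : IsTestFun univ φ) :
    ∫ x, (V x * η x) * lap φ x =
      ∫ x, (f x * η x + ∑ i, (2 * (G i x * pd i η x) + V x * pd i (pd i η) x)) * φ x := by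
  have h1 : ∀ i, ∫ x, (V x * η x) * pd i (pd i φ) x =
      - (∫ x, G i x * pd i (fun y => η y * φ y) x) +
        (∫ x, (2 * (G i x * pd i η x) + V x * pd i (pd i η) x) * φ x) := by
    intro i
    -- The rearrangement leaves `V` paired only with full derivatives of functions supported in `O`,
    -- to which `hVG` applies, and with the undifferentiated `φ`.
    have e1 : ∀ x, (V x * η x) * pd i (pd i φ) x =
        V x * pd i (fun y => η y * pd i φ y) x - V x * pd i (fun y => pd i η y * φ y) x
          + V x * (pd i (pd i η) x * φ x) := by
      intro x
      rw [pd_mul hη.1 (hφ.1.pd i), pd_mul (hη.1.pd i) hφ.1]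
      ring
    have e2 : ∀ x, (2 * (G i x * pd i η x) + V x * pd i (pd i η) x) * φ x =
        G i x * (pd i η x * φ x) + G i x * (pd i η x * φ x) + V x * (pd i (pd i η) x * φ x) := by
      intro x; ring
    have e3 : ∀ x, G i x * pd i (fun y => η y * φ y) x =
        G i x * (η x * pd i φ x) + G i x * (pd i η x * φ x) := by
      intro x; rw [pd_mul hη.1 hφ.1]; ring
    have t1 := hη.mul_right (hφ.1.pd i)
    have t2 := (hη.pd i).mul_right hφ.1
    have t3 := ((hη.pd i).pd i).mul_right hφ.1
    simp_rw [e1, e2, e3]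
    have i1 : Integrable (fun x => V x * pd i (fun y => η y * pd i φ y) x
        - V x * pd i (fun y => pd i η y * φ y) x) volume :=
      ((t1.pd i).integrable_mul hV).sub ((t2.pd i).integrable_mul hV)
    have i2 : Integrable (fun x => G i x * (pd i η x * φ x) + G i x * (pd i η x * φ x)) volume :=
      (t2.integrable_mul (hG i)).add (t2.integrable_mul (hG i))
    rw [integral_add i1 (t3.integrable_mul hV),
      integral_sub ((t1.pd i).integrable_mul hV) ((t2.pd i).integrable_mul hV),
      integral_add i2 (t3.integrable_mul hV),
      integral_add (t2.integrable_mul (hG i)) (t2.integrable_mul (hG i)),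
      integral_add (t1.integrable_mul (hG i)) (t2.integrable_mul (hG i)),
      hVG i _ t1, hVG i _ t2]
    ring
  have hi : ∀ i, Integrable
      (fun x => (2 * (G i x * pd i η x) + V x * pd i (pd i η) x) * φ x) volume := fun i =>
    hφ.integrable_mul ((((hη.pd i).memLp_mul (hG i)).const_mul 2).add
      (((hη.pd i).pd i).memLp_mul hV))
  simp only [lap, Finset.mul_sum, add_mul, Finset.sum_mul] at hi ⊢
  rw [integral_finsetSum _ fun i _ => ((hφ.pd i).pd i).integrable_mul (hη.memLp_mul hV),
    integral_add (hφ.integrable_mul (hη.memLp_mul hf)) (integrable_finsetSum _ fun i _ => hi i),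
    integral_finsetSum _ fun i _ => hi i]
  simp only [h1, add_mul]
  rw [Finset.sum_add_distrib, Finset.sum_neg_distrib, hGf _ (hη.mul_right hφ.1), neg_neg]
  simp only [mul_assoc]

/-- Interior `W^{2,2}` regularity for the Poisson equation, in dual form. -/
theorem exists_sq_integral_mul_pd_pd_le (hV : MemLp V 2 volume)
    (hG : ∀ i, MemLp (G i) 2 volume) (hf : MemLp f 2 volume)
    (hVG : ∀ i φ, IsTestFun O φ → ∫ x, V x * pd i φ x = - ∫ x, G i x * φ x)
    (hGf : ∀ φ, IsTestFun O φ → ∑ i, ∫ x, G i x * pd i φ x = - ∫ x, f x * φ x)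
    (hη : IsTestFun O η) :
    ∃ C : ℝ, ∀ φ, IsTestFun univ φ → ∀ i j,
      (∫ x, (V x * η x) * pd i (pd j φ) x) ^ 2 ≤ C * ∫ x, φ x ^ 2 := by
  refine ⟨_, fun φ hφ i j => sq_integral_mul_pd_pd_le (hη.integrable_mul hV) hη.2.1.mul_left
    (F := fun x => f x * η x + ∑ i, (2 * (G i x * pd i η x) + V x * pd i (pd i η) x)) ?_
    (fun φ hφ => integral_mul_lap_localized hV hG hf hVG hGf hη hφ) hφ i j⟩
  exact (hη.memLp_mul hf).add (memLp_finsetSum _ fun i _ =>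
    (((hη.pd i).memLp_mul (hG i)).const_mul 2).add (((hη.pd i).pd i).memLp_mul hV))

end Interior

/-- The reflection `(x', t) ↦ (x', c - t)`. -/
def axisRefl {m : ℕ} (c : ℝ) : CylSpace m ≃ₜ CylSpace m :=
  (Homeomorph.refl _).prodCongr (Homeomorph.subLeft c)

/-- The sum of `h` and of `σ` times its reflections in the hyperplanes `t = 0` and `t = 1`. -/
def reflSum {m : ℕ} (σ : ℝ) (h : CylSpace m → ℝ) : CylSpace m → ℝ :=
  fun x => h x + σ * h (axisRefl 0 x) + σ * h (axisRefl 2 x)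

/-- The sign by which reflections along the axis act on the `i`-th coordinate direction. -/
def axisSign {m : ℕ} (i : Fin (m + 1)) : ℝ := if i = Fin.last m then -1 else 1

/-! ### Reflection in the flat faces. -/

section Reflection

variable {m : ℕ} {c σ : ℝ} {h k φ : CylSpace m → ℝ} {D D' : Set (EuclideanSpace ℝ (Fin m))}
  {O : Set (CylSpace m)} {U f η : CylSpace m → ℝ} {G : Fin (m + 1) → CylSpace m → ℝ}

@[simp] theorem axisRefl_apply (x : CylSpace m) : axisRefl c x = (x.1, c - x.2) := rfl

theorem axisRefl_axisRefl (x : CylSpace m) : axisRefl c (axisRefl c x) = x := by simp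

theorem axisSign_mul_self (i : Fin (m + 1)) : axisSign i * axisSign i = 1 := by
  unfold axisSign; split_ifs <;> norm_num

theorem measurePreserving_axisRefl :
    MeasurePreserving (axisRefl c : CylSpace m → CylSpace m) volume volume :=
  (MeasurePreserving.id volume).prod (Measure.measurePreserving_sub_left volume c)

theorem integral_comp_axisRefl (h : CylSpace m → ℝ) : ∫ x, h (axisRefl c x) = ∫ x, h x :=
  measurePreserving_axisRefl.integral_comp (axisRefl c).measurableEmbedding h

theorem memLp_comp_axisRefl (hh : MemLp h 2 volume) :
    MemLp (fun x => h (axisRefl c x)) 2 volume :=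
  hh.comp_measurePreserving measurePreserving_axisRefl

theorem memLp_reflSum (hh : MemLp h 2 volume) : MemLp (reflSum σ h) 2 volume :=
  (hh.add ((memLp_comp_axisRefl hh).const_mul σ)).add ((memLp_comp_axisRefl hh).const_mul σ)

theorem integral_comp_axisRefl_mul (h k : CylSpace m → ℝ) :
    ∫ x, h (axisRefl c x) * k x = ∫ x, h x * k (axisRefl c x) := by
  rw [← integral_comp_axisRefl (c := c)]
  simp only [axisRefl_axisRefl]

/-- Each reflection is a measure preserving involution, so `reflSum` is self-adjoint. Equations for
a reflected function thereby become equations for the original one with a reflected test function.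
-/
theorem integral_reflSum_mul (hh : MemLp h 2 volume) (hk : MemLp k 2 volume) :
    ∫ x, reflSum σ h x * k x = ∫ x, h x * reflSum σ k x := by
  have i0 : Integrable (fun x => h x * k x) volume := hh.integrable_mul hk
  have i1 : ∀ c, Integrable (fun x => σ * (h (axisRefl c x) * k x)) volume := fun c =>
    ((memLp_comp_axisRefl hh).integrable_mul hk).const_mul σ
  have i2 : ∀ c, Integrable (fun x => σ * (h x * k (axisRefl c x))) volume := fun c =>
    (hh.integrable_mul (memLp_comp_axisRefl hk)).const_mul σ
  have e1 : ∀ x, reflSum σ h x * k x =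
      (h x * k x + σ * (h (axisRefl 0 x) * k x)) + σ * (h (axisRefl 2 x) * k x) := by
    intro x; unfold reflSum; ring
  have e2 : ∀ x, h x * reflSum σ k x =
      (h x * k x + σ * (h x * k (axisRefl 0 x))) + σ * (h x * k (axisRefl 2 x)) := by
    intro x; unfold reflSum; ring
  have j1 : Integrable (fun x => h x * k x + σ * (h (axisRefl 0 x) * k x)) volume := i0.add (i1 0)
  have j2 : Integrable (fun x => h x * k x + σ * (h x * k (axisRefl 0 x))) volume := i0.add (i2 0)
  simp_rw [e1, e2]
  rw [integral_add j1 (i1 2), integral_add i0 (i1 0),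
    integral_add j2 (i2 2), integral_add i0 (i2 0)]
  simp only [integral_const_mul, integral_comp_axisRefl_mul]

theorem contDiff_axisRefl : ContDiff ℝ ∞ (axisRefl c : CylSpace m → CylSpace m) :=
  contDiff_fst.prodMk (contDiff_const.sub contDiff_snd)

theorem pd_comp_axisRefl (hφ : ContDiff ℝ ∞ φ) (i : Fin (m + 1)) (x : CylSpace m) :
    pd i (fun y => φ (axisRefl c y)) x = axisSign i * pd i φ (axisRefl c x) := by
  have h1 : HasFDerivAt (axisRefl c : CylSpace m → CylSpace m)
      ((ContinuousLinearMap.fst ℝ _ ℝ).prod (-ContinuousLinearMap.snd ℝ _ ℝ)) x :=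
    hasFDerivAt_fst.prodMk (hasFDerivAt_snd.const_sub c)
  have h2 := ((hφ.diff (axisRefl c x)).hasFDerivAt.comp x h1).fderiv
  have h3 : ((coordVec m i).1, -(coordVec m i).2) = axisSign i • coordVec m i := by
    unfold axisSign coordVec
    refine Fin.lastCases ?_ (fun j => ?_) i
    · simp
    · simp [(Fin.castSucc_lt_last j).ne]
  unfold pd
  rw [← smul_eq_mul, ← map_smul, ← h3]
  exact congrArg (fun A => A (coordVec m i)) h2

theorem IsTestFun.comp_axisRefl (hφ : IsTestFun O φ) :
    IsTestFun (axisRefl c ⁻¹' O) (fun x => φ (axisRefl c x)) := by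
  refine ⟨hφ.1.comp contDiff_axisRefl, hφ.2.1.comp_homeomorph _, ?_⟩
  rw [show (fun x => φ (axisRefl c x)) = φ ∘ axisRefl c from rfl,
    tsupport_comp_eq_preimage φ (axisRefl c)]
  exact preimage_mono hφ.2.2

theorem IsTestFun.reflSum (hφ : IsTestFun (D ×ˢ univ) φ) : IsTestFun (D ×ˢ univ) (reflSum σ φ) := by
  have h : ∀ c, (axisRefl c : CylSpace m → CylSpace m) ⁻¹' (D ×ˢ univ) = D ×ˢ univ := by
    intro c; ext x; simp
  have h' : ∀ c, IsTestFun (D ×ˢ univ) (fun x => φ (axisRefl c x)) := fun c => by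
    have := hφ.comp_axisRefl (c := c)
    rwa [h] at this
  exact (hφ.add ((h' 0).const_mul σ)).add ((h' 2).const_mul σ)

theorem pd_reflSum (hφ : ContDiff ℝ ∞ φ) (i : Fin (m + 1)) :
    pd i (reflSum σ φ) = reflSum (σ * axisSign i) (pd i φ) := by
  funext x
  have h' : ∀ c, ContDiff ℝ ∞ (fun x : CylSpace m => φ (axisRefl c x)) := fun c =>
    hφ.comp contDiff_axisRefl
  unfold reflSum
  rw [pd_add (hφ.add (contDiff_const.mul (h' 0))) (contDiff_const.mul (h' 2)),
    pd_add hφ (contDiff_const.mul (h' 0)), pd_const_mul (h' 0), pd_const_mul (h' 2),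
    pd_comp_axisRefl hφ, pd_comp_axisRefl hφ]
  ring

theorem exists_isTestFun_eq_one {K : Set (CylSpace m)} (hK : IsCompact K) (hO : IsOpen O)
    (hKO : K ⊆ O) : ∃ η, IsTestFun O η ∧ ∀ x ∈ K, η x = 1 := by
  obtain ⟨V, hV, hKV, hVO, hVc⟩ := exists_open_between_and_isCompact_closure hK hO hKO
  obtain ⟨η, h0, h1, -⟩ := exists_contMDiffMap_zero_one_of_isClosed (n := (⊤ : ℕ∞))
    (modelWithCornersSelf ℝ (CylSpace m)) hV.isClosed_compl hK.isClosed
    (disjoint_left.2 fun x hx hx' => hx (hKV hx'))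
  have hs : tsupport η ⊆ closure V := closure_mono fun x hx => by
    by_contra h
    exact hx (h0 h)
  exact ⟨η, ⟨η.contMDiff.contDiff, hVc.of_isClosed_subset (isClosed_tsupport _) hs,
    hs.trans hVO⟩, h1⟩

/-- `W^{2,2}` regularity, in dual form, up to the flat faces of a cylinder for weak solutions of
the Poisson equation that vanish there. All functions are extended by zero. -/
theorem exists_sq_integral_mul_pd_pd_le_of_cylinder (hD : IsOpen D)
    (hD'c : IsCompact (closure D')) (hD' : closure D' ⊆ D) (hU : MemLp U 2 volume)
    (hG : ∀ i, MemLp (G i) 2 volume) (hf : MemLp f 2 volume)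
    (hU0 : ∀ x, x.2 ∉ Ioo (0 : ℝ) 1 → U x = 0)
    (hUG : ∀ i φ, IsTestFun (D ×ˢ univ) φ → ∫ x, U x * pd i φ x = - ∫ x, G i x * φ x)
    (hGf : ∀ φ, IsTestFun (D ×ˢ univ) φ → (∀ x', φ (x', 0) = 0) → (∀ x', φ (x', 1) = 0) →
      ∑ i, ∫ x, G i x * pd i φ x = - ∫ x, f x * φ x) :
    ∃ C : ℝ, ∀ φ, IsTestFun (barrel D') φ → ∀ i j,
      (∫ x, U x * pd i (pd j φ) x) ^ 2 ≤ C * ∫ x, φ x ^ 2 := by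
  have hO : D ×ˢ Ioo (-1 : ℝ) 2 ⊆ D ×ˢ (univ : Set ℝ) := prod_mono_right (subset_univ _)
  obtain ⟨η, hη, hη1⟩ := exists_isTestFun_eq_one (m := m) (K := closure D' ×ˢ Icc (0 : ℝ) 1)
    (hD'c.prod isCompact_Icc) (hD.prod (isOpen_Ioo (a := (-1 : ℝ)) (b := 2)))
    (prod_mono hD' (Icc_subset_Ioo (by norm_num) (by norm_num)))
  obtain ⟨C, hC⟩ := exists_sq_integral_mul_pd_pd_le (V := reflSum (-1) U)
    (G := fun i => reflSum (-1 * axisSign i) (G i)) (f := reflSum (-1) f) (memLp_reflSum hU)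
    (fun i => memLp_reflSum (hG i)) (memLp_reflSum hf)
    (fun i φ hφ => by
      rw [integral_reflSum_mul hU ((hφ.pd i).memLp 2), integral_reflSum_mul (hG i) (hφ.memLp 2),
        ← hUG i _ (hφ.mono hO).reflSum, pd_reflSum hφ.1, mul_assoc, axisSign_mul_self, mul_one])
    (fun φ hφ => by
      -- The reflected test function vanishes on both faces: at `t = 0` only `-φ(x', 2)` survives
      -- and at `t = 1` only `-φ(x', -1)`, and both are zero. This is why the cutoff is confined to
      -- `-1 < t < 2`.
      have hout : ∀ x' t, t ∉ Ioo (-1 : ℝ) 2 → φ (x', t) = 0 := fun x' t ht =>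
        image_eq_zero_of_notMem_tsupport fun h => ht (hφ.2.2 h).2
      have := hGf (reflSum (-1) φ) (hφ.mono hO).reflSum
        (fun x' => by simp [reflSum, hout x' 2])
        (fun x' => by
          simp only [reflSum, axisRefl_apply, zero_sub, hout x' (-1) (by simp)]
          norm_num)
      rw [integral_reflSum_mul hf (hφ.memLp 2), ← this]
      refine Finset.sum_congr rfl fun i _ => ?_
      rw [integral_reflSum_mul (hG i) ((hφ.pd i).memLp 2), pd_reflSum hφ.1])
    hη
  refine ⟨C, fun φ hφ i j => ?_⟩
  -- Inside `barrel D'` the cutoff is `1`, and the reflected copies of `U` live outside `0 < t < 1`,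
  -- so the localized odd extension is `U` itself.
  have key : ∀ x, U x * pd i (pd j φ) x =
      (reflSum (-1) U x * η x) * pd i (pd j φ) x := by
    intro x
    by_cases hx : x ∈ barrel D'
    · have h2 : x.2 ∈ Ioo (0 : ℝ) 1 := hx.2
      rw [hη1 x ⟨subset_closure hx.1, Ioo_subset_Icc_self h2⟩, reflSum,
        hU0 (axisRefl 0 x) (fun h => by simp at h; linarith [h.1, h2.1]),
        hU0 (axisRefl 2 x) (fun h => by simp at h; linarith [h.1, h2.2])]
      ring
    · have : pd i (pd j φ) x = 0 :=
        image_eq_zero_of_notMem_tsupport fun h => hx (((hφ.pd j).pd i).2.2 h)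
      rw [this, mul_zero, mul_zero]
  simp_rw [key]
  exact hC φ hφ.to_univ i j

end Reflection

/-- A smooth cutoff in the axial variable that vanishes near `0` and `1` and is equal to `1` on
`[δ, 1 - δ]`. -/
def axisCutoff (δ t : ℝ) : ℝ :=
  Real.smoothTransition (3 * t / δ - 1) * Real.smoothTransition (3 * (1 - t) / δ - 1)

/-! ### Axial cutoffs and the vanishing of boundary layer terms. -/

section Cutoff

variable {m : ℕ} {D : Set (EuclideanSpace ℝ (Fin m))} {Ω : Set (CylSpace m)}
  {a h h' ψ u w : CylSpace m → ℝ} {i : Fin (m + 1)} {δ : ℝ}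

theorem contDiff_axisCutoff (δ : ℝ) : ContDiff ℝ ∞ (axisCutoff δ) :=
  (Real.smoothTransition.contDiff.comp (((contDiff_const.mul contDiff_id).div_const _).sub
    contDiff_const)).mul (Real.smoothTransition.contDiff.comp
      (((contDiff_const.mul (contDiff_const.sub contDiff_id)).div_const _).sub contDiff_const))

theorem axisCutoff_nonneg (δ t : ℝ) : 0 ≤ axisCutoff δ t :=
  mul_nonneg (Real.smoothTransition.nonneg _) (Real.smoothTransition.nonneg _)

theorem axisCutoff_le_one (δ t : ℝ) : axisCutoff δ t ≤ 1 :=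
  mul_le_one₀ (Real.smoothTransition.le_one _) (Real.smoothTransition.nonneg _)
    (Real.smoothTransition.le_one _)

theorem axisCutoff_eq_zero (hδ : 0 < δ) {t : ℝ} (ht : t ∉ Icc (δ / 3) (1 - δ / 3)) :
    axisCutoff δ t = 0 := by
  unfold axisCutoff
  rw [mem_Icc, not_and_or, not_le, not_le] at ht
  rcases ht with ht | ht
  · rw [Real.smoothTransition.zero_of_nonpos, zero_mul]
    rw [sub_nonpos, div_le_one hδ]; linarith
  · rw [Real.smoothTransition.zero_of_nonpos (x := 3 * (1 - t) / δ - 1), mul_zero]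
    rw [sub_nonpos, div_le_one hδ]; linarith

theorem axisCutoff_eq_one (hδ : 0 < δ) {t : ℝ} (h0 : 2 * δ / 3 ≤ t) (h1 : t ≤ 1 - 2 * δ / 3) :
    axisCutoff δ t = 1 := by
  unfold axisCutoff
  rw [Real.smoothTransition.one_of_one_le, Real.smoothTransition.one_of_one_le, one_mul]
  · rw [le_sub_iff_add_le, le_div_iff₀ hδ]; linarith
  · rw [le_sub_iff_add_le, le_div_iff₀ hδ]; linarith

theorem exists_abs_deriv_smoothTransition_le :
    ∃ M : ℝ, ∀ s, |deriv Real.smoothTransition s| ≤ M := by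
  have hc : Continuous (deriv Real.smoothTransition) :=
    (Real.smoothTransition.contDiff (n := 1)).continuous_deriv (by simp)
  have hs : HasCompactSupport (deriv Real.smoothTransition) := by
    refine HasCompactSupport.intro (isCompact_Icc (a := (0 : ℝ)) (b := 1)) fun s hs => ?_
    rw [mem_Icc, not_and_or, not_le, not_le] at hs
    rcases hs with hs | hs
    · have : Real.smoothTransition =ᶠ[𝓝 s] fun _ => 0 := by
        filter_upwards [Iio_mem_nhds hs] with t ht
        exact Real.smoothTransition.zero_of_nonpos (le_of_lt ht)
      rw [this.deriv_eq, deriv_const]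
    · have : Real.smoothTransition =ᶠ[𝓝 s] fun _ => 1 := by
        filter_upwards [Ioi_mem_nhds hs] with t ht
        exact Real.smoothTransition.one_of_one_le (le_of_lt ht)
      rw [this.deriv_eq, deriv_const]
  exact hc.bounded_above_of_compact_support hs

theorem exists_abs_deriv_axisCutoff_le :
    ∃ M : ℝ, 0 ≤ M ∧ ∀ δ, 0 < δ → ∀ t, |deriv (axisCutoff δ) t| ≤ M / δ := by
  obtain ⟨M, hM⟩ := exists_abs_deriv_smoothTransition_le
  have hM0 : 0 ≤ M := (abs_nonneg _).trans (hM 0)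
  -- Each of the two factors contributes at most `3M / δ` by the chain rule.
  refine ⟨6 * M, by positivity, fun δ hδ t => ?_⟩
  have hd : ∀ s, HasDerivAt Real.smoothTransition (deriv Real.smoothTransition s) s := fun s =>
    ((Real.smoothTransition.contDiff (n := 1)).differentiable (by simp) s).hasDerivAt
  have h1 : HasDerivAt (fun t : ℝ => 3 * t / δ - 1) (3 / δ) t := by
    simpa using (((hasDerivAt_id t).const_mul 3).div_const δ).sub_const 1
  have h2 : HasDerivAt (fun t : ℝ => 3 * (1 - t) / δ - 1) (-3 / δ) t := by
    simpa using ((((hasDerivAt_id t).const_sub 1).const_mul 3).div_const δ).sub_const 1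
  have h3 := ((hd _).comp t h1).mul ((hd _).comp t h2)
  rw [show axisCutoff δ = (Real.smoothTransition ∘ fun t : ℝ => 3 * t / δ - 1) *
    (Real.smoothTransition ∘ fun t : ℝ => 3 * (1 - t) / δ - 1) from rfl, h3.deriv]
  simp only [Function.comp]
  set A := deriv Real.smoothTransition (3 * t / δ - 1)
  set B := deriv Real.smoothTransition (3 * (1 - t) / δ - 1)
  set p := Real.smoothTransition (3 * t / δ - 1)
  set q := Real.smoothTransition (3 * (1 - t) / δ - 1)
  have hA : |A| ≤ M := hM _
  have hB : |B| ≤ M := hM _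
  have hp : |p| ≤ 1 := by
    rw [abs_of_nonneg (Real.smoothTransition.nonneg _)]; exact Real.smoothTransition.le_one _
  have hq : |q| ≤ 1 := by
    rw [abs_of_nonneg (Real.smoothTransition.nonneg _)]; exact Real.smoothTransition.le_one _
  calc |A * (3 / δ) * q + p * (B * (-3 / δ))|
      ≤ |A * (3 / δ) * q| + |p * (B * (-3 / δ))| := abs_add_le _ _
    _ = |A| * (3 / δ) * |q| + |p| * (|B| * (3 / δ)) := by
        simp only [abs_mul, abs_div, abs_neg, abs_of_pos hδ]; norm_num
    _ ≤ M * (3 / δ) * 1 + 1 * (M * (3 / δ)) := by gcongr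
    _ = 6 * M / δ := by ring

theorem deriv_axisCutoff_eq_zero (hδ : 0 < δ) {t : ℝ} (h0 : δ ≤ t) (h1 : t ≤ 1 - δ) :
    deriv (axisCutoff δ) t = 0 := by
  have : axisCutoff δ =ᶠ[𝓝 t] fun _ => 1 := by
    filter_upwards [Ioo_mem_nhds (show 2 * δ / 3 < t by linarith)
      (show t < 1 - 2 * δ / 3 by linarith)] with s hs
    exact axisCutoff_eq_one hδ hs.1.le hs.2.le
  rw [this.deriv_eq, deriv_const]

theorem abs_coordVec_snd_le (i : Fin (m + 1)) : |(coordVec m i).2| ≤ 1 := by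
  unfold coordVec
  refine Fin.lastCases ?_ (fun j => ?_) i <;> simp

theorem contDiff_comp_snd {χ : ℝ → ℝ} (hχ : ContDiff ℝ ∞ χ) :
    ContDiff ℝ ∞ (fun x : CylSpace m => χ x.2) :=
  hχ.comp contDiff_snd

theorem pd_comp_snd {χ : ℝ → ℝ} (hχ : ContDiff ℝ ∞ χ) (i : Fin (m + 1)) (x : CylSpace m) :
    pd i (fun y => χ y.2) x = deriv χ x.2 * (coordVec m i).2 := by
  have h := ((hχ.differentiable (by simp) x.2).hasDerivAt.comp_hasFDerivAt x
    (hasFDerivAt_snd (𝕜 := ℝ) (p := x))).fderiv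
  unfold pd
  rw [show (fun y : CylSpace m => χ y.2) = χ ∘ Prod.snd from rfl, h]
  simp

theorem abs_pd_comp_snd_le {χ : ℝ → ℝ} (hχ : ContDiff ℝ ∞ χ) (i : Fin (m + 1))
    (x : CylSpace m) : |pd i (fun y => χ y.2) x| ≤ |deriv χ x.2| := by
  rw [pd_comp_snd hχ, abs_mul]
  exact mul_le_of_le_one_right (abs_nonneg _) (abs_coordVec_snd_le i)

theorem isTestFun_axisCutoff_mul (hδ : 0 < δ) (hψ : IsTestFun (D ×ˢ univ) ψ) :
    IsTestFun (barrel D) (fun x => axisCutoff δ x.2 * ψ x) := by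
  have h := hψ.mul_left (contDiff_comp_snd (m := m) (contDiff_axisCutoff δ))
  refine ⟨h.1, h.2.1, fun x hx => ⟨(h.2.2 hx).1, ?_⟩⟩
  have hcl : tsupport (fun x : CylSpace m => axisCutoff δ x.2 * ψ x) ⊆
      Prod.snd ⁻¹' Icc (δ / 3) (1 - δ / 3) := by
    refine closure_minimal (fun y hy => ?_) (isClosed_Icc.preimage continuous_snd)
    by_contra hy'
    exact hy (by simp [axisCutoff_eq_zero hδ hy'])
  have := hcl hx
  exact ⟨by linarith [this.1], by linarith [this.2]⟩

theorem measurableSet_barrel (hD : IsOpen D) : MeasurableSet (barrel D) :=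
  (hD.prod isOpen_Ioo).measurableSet

theorem tendsto_integral_axisCutoff_mul (hD : IsOpen D)
    (ha : Integrable a (volume.restrict (barrel D))) :
    Tendsto (fun δ : ℝ => ∫ x in barrel D, axisCutoff δ x.2 * a x) (𝓝[>] 0)
      (𝓝 (∫ x in barrel D, a x)) := by
  refine tendsto_integral_filter_of_dominated_convergence (fun x => |a x|) ?_ ?_ ha.abs ?_
  · refine Eventually.of_forall fun δ => ?_
    exact (contDiff_comp_snd (contDiff_axisCutoff δ)).continuous.aestronglyMeasurable.mul ha.1
  · refine Eventually.of_forall fun δ => ae_of_all _ fun x => ?_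
    rw [norm_mul, Real.norm_eq_abs, Real.norm_eq_abs, abs_of_nonneg (axisCutoff_nonneg _ _)]
    exact mul_le_of_le_one_left (abs_nonneg _) (axisCutoff_le_one _ _)
  · refine (ae_restrict_iff' (measurableSet_barrel hD)).2 (ae_of_all _ fun x hx => ?_)
    have hx2 : x.2 ∈ Ioo (0 : ℝ) 1 := hx.2
    refine tendsto_const_nhds.congr' ?_
    filter_upwards [self_mem_nhdsWithin,
      Ioo_mem_nhdsGT (lt_min hx2.1 (sub_pos.2 hx2.2))] with δ hδ hδ'
    have h1 := (lt_min_iff.1 hδ'.2)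
    have hδ0 : 0 < δ := hδ
    rw [axisCutoff_eq_one hδ0 (by linarith [h1.1]) (by linarith [h1.2]), one_mul]

theorem pd_axisCutoff_eq_zero (hδ : 0 < δ) (x : CylSpace m) (h0 : δ ≤ x.2) (h1 : x.2 ≤ 1 - δ) :
    pd i (fun y => axisCutoff δ y.2) x = 0 := by
  rw [pd_comp_snd (contDiff_axisCutoff δ), deriv_axisCutoff_eq_zero hδ h0 h1, zero_mul]

theorem IsTestFun.abs_le_of_eq_zero_of_faces (hψ : IsTestFun Ω ψ) (h0 : ∀ x', ψ (x', 0) = 0)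
    (h1 : ∀ x', ψ (x', 1) = 0) : ∃ L : ℝ, 0 ≤ L ∧ ∀ x, |ψ x| ≤ L * |x.2| ∧ |ψ x| ≤ L * |1 - x.2| := by
  obtain ⟨L, hL⟩ := (hψ.1.of_le (by exact_mod_cast le_top) :
    ContDiff ℝ 1 ψ).lipschitzWith_of_hasCompactSupport hψ.2.1 (by simp)
  refine ⟨L, L.2, fun x => ⟨?_, ?_⟩⟩
  · have := hL.dist_le_mul x (x.1, 0)
    rw [Real.dist_eq, h0, sub_zero] at this
    simpa [Prod.dist_eq, Real.dist_eq] using this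
  · have := hL.dist_le_mul x (x.1, 1)
    rw [Real.dist_eq, h1, sub_zero] at this
    simpa [Prod.dist_eq, Real.dist_eq, abs_sub_comm] using this

/-- The derivative of the cutoff is `O(1/δ)` and lives within `δ` of the faces, where `ψ = O(δ)`
because it is Lipschitz and vanishes on them. The product is bounded and eventually zero at each
point, so dominated convergence applies. -/
theorem tendsto_integral_mul_pd_axisCutoff (hD : IsOpen D)
    (ha : Integrable a (volume.restrict (barrel D))) (hψ : IsTestFun Ω ψ)
    (h0 : ∀ x', ψ (x', 0) = 0) (h1 : ∀ x', ψ (x', 1) = 0) (i : Fin (m + 1)) :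
    Tendsto (fun δ : ℝ => ∫ x in barrel D, a x * (pd i (fun y => axisCutoff δ y.2) x * ψ x))
      (𝓝[>] 0) (𝓝 0) := by
  obtain ⟨M, hM0, hM⟩ := exists_abs_deriv_axisCutoff_le
  obtain ⟨L, hL0, hL⟩ := hψ.abs_le_of_eq_zero_of_faces h0 h1
  suffices H : Tendsto
      (fun δ : ℝ => ∫ x in barrel D, a x * (pd i (fun y => axisCutoff δ y.2) x * ψ x))
      (𝓝[>] 0) (𝓝 (∫ x in barrel D, (0 : ℝ))) by simpa using H
  refine tendsto_integral_filter_of_dominated_convergence (fun x => |a x| * (M * L)) ?_ ?_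
    (ha.abs.mul_const _) ?_
  · refine Eventually.of_forall fun δ => ha.1.mul ?_
    exact (((contDiff_comp_snd (contDiff_axisCutoff δ)).pd i).mul
      hψ.1).continuous.aestronglyMeasurable
  · filter_upwards [self_mem_nhdsWithin] with δ hδ
    have hδ0 : 0 < δ := hδ
    refine (ae_restrict_iff' (measurableSet_barrel hD)).2 (ae_of_all _ fun x hx => ?_)
    have hx2 : x.2 ∈ Ioo (0 : ℝ) 1 := hx.2
    rw [norm_mul, Real.norm_eq_abs]
    gcongr
    rw [norm_mul, Real.norm_eq_abs, Real.norm_eq_abs]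
    by_cases hin : δ ≤ x.2 ∧ x.2 ≤ 1 - δ
    · rw [pd_axisCutoff_eq_zero hδ0 x hin.1 hin.2]
      simp only [abs_zero, zero_mul]; positivity
    · have hψx : |ψ x| ≤ L * δ := by
        rw [not_and_or, not_le, not_le] at hin
        rcases hin with hin | hin
        · refine (hL x).1.trans ?_
          rw [abs_of_pos hx2.1]; gcongr
        · refine (hL x).2.trans ?_
          rw [abs_of_pos (sub_pos.2 hx2.2)]; gcongr; linarith
      calc _ ≤ M / δ * (L * δ) :=
            mul_le_mul ((abs_pd_comp_snd_le (contDiff_axisCutoff δ) i x).trans (hM δ hδ0 _)) hψx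
              (abs_nonneg _) (by positivity)
        _ = M * L := by field_simp
  · refine (ae_restrict_iff' (measurableSet_barrel hD)).2 (ae_of_all _ fun x hx => ?_)
    have hx2 : x.2 ∈ Ioo (0 : ℝ) 1 := hx.2
    refine tendsto_const_nhds.congr' ?_
    filter_upwards [self_mem_nhdsWithin,
      Ioo_mem_nhdsGT (lt_min hx2.1 (sub_pos.2 hx2.2))] with δ hδ hδ'
    have h1 := (lt_min_iff.1 hδ'.2)
    rw [pd_axisCutoff_eq_zero hδ x h1.1.le (by linarith [h1.2]), zero_mul, mul_zero]

/-- Cauchy–Schwarz on a layer of volume at most `Vδ` gives `(δ⁻¹ ∫ |h|)² ≤ V δ⁻¹ ∫ h²`. -/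
theorem tendsto_inv_mul_integral_abs {B : Set (CylSpace m)} {S : ℝ → Set (CylSpace m)} {V : ℝ}
    (hV : 0 ≤ V)
    (hSB : ∀ δ ∈ Ioo (0 : ℝ) 1, S δ ⊆ B)
    (hSV : ∀ δ ∈ Ioo (0 : ℝ) 1, volume (S δ) ≤ ENNReal.ofReal (V * δ))
    (hh : MemLp h 2 (volume.restrict B))
    (ht : Tendsto (fun δ : ℝ => (ENNReal.ofReal δ)⁻¹ *
      ∫⁻ x in S δ, ENNReal.ofReal (h x ^ 2)) (𝓝[>] 0) (𝓝 0)) :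
    Tendsto (fun δ : ℝ => δ⁻¹ * ∫ x in S δ, |h x|) (𝓝[>] 0) (𝓝 0) := by
  have h1 := (ENNReal.continuousAt_toReal (by simp : (0 : ℝ≥0∞) ≠ ⊤)).tendsto.comp ht
  have h2 : Tendsto (fun δ : ℝ => √(V * ((ENNReal.ofReal δ)⁻¹ *
      ∫⁻ x in S δ, ENNReal.ofReal (h x ^ 2)).toReal)) (𝓝[>] 0) (𝓝 0) := by
    have := (h1.const_mul V).sqrt
    simpa using this
  refine squeeze_zero' ?_ ?_ h2
  · filter_upwards [self_mem_nhdsWithin] with δ hδ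
    exact mul_nonneg (inv_nonneg.2 (le_of_lt hδ)) (integral_nonneg fun x => abs_nonneg _)
  · filter_upwards [Ioo_mem_nhdsGT one_pos] with δ hδ
    have hδ0 : 0 < δ := hδ.1
    have hhS : MemLp h 2 (volume.restrict (S δ)) :=
      hh.mono_measure (Measure.restrict_mono_set _ (hSB δ hδ))
    have hfin : IsFiniteMeasure (volume.restrict (S δ)) :=
      ⟨by simpa using (hSV δ hδ).trans_lt ENNReal.ofReal_lt_top⟩
    have hcs := sq_integral_mul_le (f := fun x => |h x|) hhS.abs (memLp_const (1 : ℝ))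
    have hvol : (volume.restrict (S δ)).real univ ≤ V * δ := by
      rw [measureReal_def, Measure.restrict_apply_univ]
      exact ENNReal.toReal_le_of_le_ofReal (by positivity) (hSV δ hδ)
    simp only [mul_one, one_pow, sq_abs, integral_const, smul_eq_mul] at hcs
    apply Real.le_sqrt_of_sq_le
    rw [← ofReal_integral_eq_lintegral_ofReal hhS.integrable_sq (ae_of_all _ fun x => sq_nonneg _),
      ENNReal.toReal_mul, ENNReal.toReal_inv, ENNReal.toReal_ofReal hδ0.le,
      ENNReal.toReal_ofReal (integral_nonneg fun x => sq_nonneg _), mul_pow]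
    have hI : 0 ≤ ∫ x in S δ, h x ^ 2 := integral_nonneg fun x => sq_nonneg _
    calc δ⁻¹ ^ 2 * (∫ x in S δ, |h x|) ^ 2 ≤ δ⁻¹ ^ 2 * ((∫ x in S δ, h x ^ 2) * (V * δ)) := by
          gcongr
          exact hcs.trans (by gcongr)
      _ = V * (δ⁻¹ * ∫ x in S δ, h x ^ 2) := by field_simp

theorem volume_prod_Ioo_le (hDf : volume D ≠ ⊤) {a b : ℝ} :
    volume (D ×ˢ Ioo a b) ≤ ENNReal.ofReal ((volume D).toReal * (b - a)) := by
  rw [Measure.volume_eq_prod, Measure.prod_prod, Real.volume_Ioo,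
    ENNReal.ofReal_mul ENNReal.toReal_nonneg, ENNReal.ofReal_toReal hDf]

theorem isFiniteMeasure_restrict_barrel (hDf : volume D ≠ ⊤) :
    IsFiniteMeasure (volume.restrict (barrel D)) := by
  refine ⟨?_⟩
  rw [Measure.restrict_apply_univ]
  exact (volume_prod_Ioo_le hDf).trans_lt ENNReal.ofReal_lt_top

/-- Counterpart of `tendsto_integral_mul_pd_axisCutoff` in which `ψ` is merely bounded: the factor
`1/δ` is now absorbed by the zero trace of `h`. -/
theorem tendsto_integral_mul_pd_axisCutoff_of_trace (hD : IsOpen D) (hDf : volume D ≠ ⊤)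
    (hh : MemLp h 2 (volume.restrict (barrel D)))
    (hb : HasBottomTrace D h 0) (ht : HasTopTrace D h 0) (hψ : IsTestFun Ω ψ)
    (i : Fin (m + 1)) :
    Tendsto (fun δ : ℝ => ∫ x in barrel D, h x * (pd i (fun y => axisCutoff δ y.2) x * ψ x))
      (𝓝[>] 0) (𝓝 0) := by
  obtain ⟨M, hM0, hM⟩ := exists_abs_deriv_axisCutoff_le
  obtain ⟨L, hL⟩ := hψ.bdd
  have hL0 : 0 ≤ L := (norm_nonneg _).trans (hL 0)
  have hsub1 : ∀ δ ∈ Ioo (0 : ℝ) 1, D ×ˢ Ioo (0 : ℝ) δ ⊆ barrel D := fun δ hδ =>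
    prod_mono_right (Ioo_subset_Ioo_right hδ.2.le)
  have hsub2 : ∀ δ ∈ Ioo (0 : ℝ) 1, D ×ˢ Ioo (1 - δ) (1 : ℝ) ⊆ barrel D := fun δ hδ =>
    prod_mono_right (Ioo_subset_Ioo_left (by linarith [hδ.2]))
  have hb' := tendsto_inv_mul_integral_abs (V := (volume D).toReal) ENNReal.toReal_nonneg hsub1
    (fun δ hδ => by simpa using volume_prod_Ioo_le hDf (a := 0) (b := δ)) hh
    (by simpa [HasBottomTrace] using hb)
  have ht' := tendsto_inv_mul_integral_abs (V := (volume D).toReal) ENNReal.toReal_nonneg hsub2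
    (fun δ hδ => by simpa using volume_prod_Ioo_le hDf (a := 1 - δ) (b := 1)) hh
    (by simpa [HasTopTrace] using ht)
  have hlim := ((hb'.add ht').const_mul (M * L))
  rw [add_zero, mul_zero] at hlim
  refine squeeze_zero_norm' ?_ hlim
  filter_upwards [Ioo_mem_nhdsGT one_pos] with δ hδ
  have hδ0 : 0 < δ := hδ.1
  have hBfin : IsFiniteMeasure (volume.restrict (barrel D)) :=
    isFiniteMeasure_restrict_barrel hDf
  have hint : Integrable (fun x => |h x|) (volume.restrict (barrel D)) :=
    (hh.integrable (by norm_num)).abs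
  have hm1 : MeasurableSet (D ×ˢ Ioo (0 : ℝ) δ) := (hD.prod isOpen_Ioo).measurableSet
  have hm2 : MeasurableSet (D ×ˢ Ioo (1 - δ) (1 : ℝ)) := (hD.prod isOpen_Ioo).measurableSet
  have hr : ∀ T, MeasurableSet T → T ⊆ barrel D → ∫ x in T, |h x| =
      ∫ x in barrel D, T.indicator (fun x => |h x|) x := fun T hT hTB => by
    rw [setIntegral_indicator hT, inter_eq_right.2 hTB]
  rw [hr _ hm1 (hsub1 δ hδ), hr _ hm2 (hsub2 δ hδ), ← mul_add,
    ← integral_add (hint.indicator hm1) (hint.indicator hm2), ← mul_assoc, ← integral_const_mul]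
  refine norm_integral_le_of_norm_le (((hint.indicator hm1).add (hint.indicator hm2)).const_mul _)
    ((ae_restrict_iff' (measurableSet_barrel hD)).2 (ae_of_all _ fun x hx => ?_))
  have hx2 : x.2 ∈ Ioo (0 : ℝ) 1 := hx.2
  simp only [norm_mul, Real.norm_eq_abs]
  have hi1 : 0 ≤ (D ×ˢ Ioo (0 : ℝ) δ).indicator (fun x => |h x|) x :=
    indicator_nonneg (fun _ _ => abs_nonneg _) _
  have hi2 : 0 ≤ (D ×ˢ Ioo (1 - δ) (1 : ℝ)).indicator (fun x => |h x|) x :=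
    indicator_nonneg (fun _ _ => abs_nonneg _) _
  by_cases hin : δ ≤ x.2 ∧ x.2 ≤ 1 - δ
  · rw [pd_axisCutoff_eq_zero hδ0 x hin.1 hin.2]
    simp only [abs_zero, zero_mul, mul_zero]; positivity
  · have hle : |h x| ≤ (D ×ˢ Ioo (0 : ℝ) δ).indicator (fun x => |h x|) x +
        (D ×ˢ Ioo (1 - δ) (1 : ℝ)).indicator (fun x => |h x|) x := by
      rw [not_and_or, not_le, not_le] at hin
      rcases hin with hin | hin
      · rw [indicator_of_mem (show x ∈ D ×ˢ Ioo (0 : ℝ) δ from ⟨hx.1, hx2.1, hin⟩)]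
        linarith
      · rw [indicator_of_mem (show x ∈ D ×ˢ Ioo (1 - δ) (1 : ℝ) from ⟨hx.1, hin, hx2.2⟩)]
        linarith
    calc _ ≤ ((D ×ˢ Ioo (0 : ℝ) δ).indicator (fun x => |h x|) x +
        (D ×ˢ Ioo (1 - δ) (1 : ℝ)).indicator (fun x => |h x|) x) * (M / δ * L) := by
          gcongr
          · exact (abs_pd_comp_snd_le (contDiff_axisCutoff δ) i x).trans (hM δ hδ0 _)
          · exact hL x
      _ = _ := by rw [div_eq_mul_inv]; ring

end Cutoff

/-! ### Weak derivatives and integration by parts up to the flat faces. -/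

section WeakPartial

variable {m : ℕ} {D : Set (EuclideanSpace ℝ (Fin m))} {Ω Ω' : Set (CylSpace m)}
  {f h h' φ ψ u u' w w' : CylSpace m → ℝ} {G : Fin (m + 1) → CylSpace m → ℝ} {i : Fin (m + 1)}

theorem IsTestFun.integrable_mul_restrict (hφ : IsTestFun Ω' φ)
    (hf : MemLp f 2 (volume.restrict Ω)) :
    Integrable (fun x => f x * φ x) (volume.restrict Ω) :=
  hf.integrable_mul ((hφ.memLp 2).restrict Ω)

theorem IsTestFun.setIntegral_mul (hφ : IsTestFun Ω φ) (f : CylSpace m → ℝ) :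
    ∫ x in Ω, f x * φ x = ∫ x, f x * φ x :=
  setIntegral_eq_integral_of_forall_compl_eq_zero fun x hx => by
    rw [image_eq_zero_of_notMem_tsupport fun h => hx (hφ.2.2 h), mul_zero]

theorem integral_indicator_mul (hΩ : MeasurableSet Ω) (f k : CylSpace m → ℝ) :
    ∫ x, Ω.indicator f x * k x = ∫ x in Ω, f x * k x := by
  rw [← integral_indicator hΩ]
  simp_rw [indicator_mul_left]

theorem hasWeakPartial_of_contDiff (hf : ContDiff ℝ ∞ f) : HasWeakPartial Ω i f (pd i f) := by
  intro φ hφ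
  rw [hφ.setIntegral_mul]
  exact ((hφ.pd i).setIntegral_mul f).trans (integral_mul_pd hf hφ)

theorem HasWeakPartial.mono (hw : HasWeakPartial Ω i u w) (hΩ : Ω' ⊆ Ω) :
    HasWeakPartial Ω' i u w := by
  intro φ hφ
  have h := hw φ (hφ.mono hΩ)
  rw [(hφ.mono hΩ).setIntegral_mul] at h
  rw [hφ.setIntegral_mul, ← h]
  exact ((hφ.pd i).setIntegral_mul u).trans (((hφ.mono hΩ).pd i).setIntegral_mul u).symm

theorem HasWeakPartial.add (hu : MemLp u 2 (volume.restrict Ω))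
    (hu' : MemLp u' 2 (volume.restrict Ω)) (hw : MemLp w 2 (volume.restrict Ω))
    (hw' : MemLp w' 2 (volume.restrict Ω)) (h : HasWeakPartial Ω i u w)
    (h' : HasWeakPartial Ω i u' w') :
    HasWeakPartial Ω i (fun x => u x + u' x) (fun x => w x + w' x) := by
  intro φ hφ
  have e1 : ∫ x in Ω, u x * pd i φ x = _ := h φ hφ
  have e2 : ∫ x in Ω, u' x * pd i φ x = _ := h' φ hφ
  change ∫ x in Ω, (u x + u' x) * pd i φ x = _
  simp only [add_mul]
  rw [integral_add ((hφ.pd i).integrable_mul_restrict hu) ((hφ.pd i).integrable_mul_restrict hu'),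
    integral_add (hφ.integrable_mul_restrict hw) (hφ.integrable_mul_restrict hw'), e1, e2]
  ring

theorem HasWeakPartial.const_mul (h : HasWeakPartial Ω i u w) (c : ℝ) :
    HasWeakPartial Ω i (fun x => c * u x) (fun x => c * w x) := by
  intro φ hφ
  simp only [mul_assoc, integral_const_mul]
  rw [h φ hφ, mul_neg]

theorem HasWeakPartial.sub (hu : MemLp u 2 (volume.restrict Ω))
    (hu' : MemLp u' 2 (volume.restrict Ω)) (hw : MemLp w 2 (volume.restrict Ω))
    (hw' : MemLp w' 2 (volume.restrict Ω)) (h : HasWeakPartial Ω i u w)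
    (h' : HasWeakPartial Ω i u' w') :
    HasWeakPartial Ω i (fun x => u x - u' x) (fun x => w x - w' x) := by
  have := h.add hu (hu'.const_mul (-1)) hw (hw'.const_mul (-1)) (h'.const_mul (-1))
  simpa only [neg_one_mul, ← sub_eq_add_neg] using this

/-- Weak partial derivatives are unique. -/
theorem HasWeakPartial.ae_eq (hΩ : IsOpen Ω) (hw : MemLp w 2 (volume.restrict Ω))
    (hw' : MemLp w' 2 (volume.restrict Ω)) (h : HasWeakPartial Ω i u w)
    (h' : HasWeakPartial Ω i u w') : w =ᵐ[volume.restrict Ω] w' := by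
  have hd := hw.sub hw'
  have := hΩ.ae_eq_zero_of_integral_contDiff_smul_eq_zero (μ := volume) (f := w - w')
    (locallyIntegrableOn_of_locallyIntegrable_restrict (hd.locallyIntegrable (by norm_num)))
    (fun φ hφ1 hφ2 hφ3 => by
      have hφ : IsTestFun Ω φ := ⟨hφ1, hφ2, hφ3⟩
      simp_rw [smul_eq_mul, mul_comm (φ _)]
      rw [← hφ.setIntegral_mul]
      simp only [Pi.sub_apply, sub_mul]
      rw [integral_sub (hφ.integrable_mul_restrict hw) (hφ.integrable_mul_restrict hw')]
      linarith [h φ hφ, h' φ hφ])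
  filter_upwards [(ae_restrict_iff' hΩ.measurableSet).2 this] with x hx
  exact sub_eq_zero.1 hx

theorem weakPartial_spec (hu : MemW Ω 1 u) (i : Fin (m + 1)) :
    MemLp (weakPartial Ω i u) 2 (volume.restrict Ω) ∧
      HasWeakPartial Ω i u (weakPartial Ω i u) := by
  have h : ∃ w : CylSpace m → ℝ, MemLp w 2 (volume.restrict Ω) ∧ HasWeakPartial Ω i u w := hu.2 i
  unfold weakPartial
  rw [dif_pos h]
  exact h.choose_spec

theorem weakPartial_ae_eq (hΩ : IsOpen Ω) (hu : MemW Ω 1 u) (hw : MemLp w 2 (volume.restrict Ω))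
    (h : HasWeakPartial Ω i u w) : weakPartial Ω i u =ᵐ[volume.restrict Ω] w :=
  HasWeakPartial.ae_eq hΩ (weakPartial_spec hu i).1 hw (weakPartial_spec hu i).2 h

theorem MemW.memLp (hu : MemW Ω 1 u) : MemLp u 2 (volume.restrict Ω) := hu.1

theorem MemW.add (hu : MemW Ω 1 u) (hu' : MemW Ω 1 u') : MemW Ω 1 (fun x => u x + u' x) :=
  ⟨hu.1.add hu'.1, fun i => ⟨_, (weakPartial_spec hu i).1.add (weakPartial_spec hu' i).1,
    (weakPartial_spec hu i).2.add hu.1 hu'.1 (weakPartial_spec hu i).1 (weakPartial_spec hu' i).1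
      (weakPartial_spec hu' i).2⟩⟩

theorem IsTestFun.memW (hφ : IsTestFun Ω' φ) : MemW Ω 1 φ :=
  ⟨(hφ.memLp 2).restrict Ω, fun i => ⟨_root_.pd i φ, ((hφ.pd i).memLp 2).restrict Ω,
    hasWeakPartial_of_contDiff hφ.1⟩⟩

theorem weakPartial_add_ae_eq (hΩ : IsOpen Ω) (hu : MemW Ω 1 u) (hφ : IsTestFun Ω φ)
    (i : Fin (m + 1)) :
    weakPartial Ω i (fun x => u x + φ x) =ᵐ[volume.restrict Ω]
      fun x => weakPartial Ω i u x + pd i φ x :=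
  weakPartial_ae_eq hΩ (hu.add hφ.memW)
    ((weakPartial_spec hu i).1.add (((hφ.pd i).memLp 2).restrict Ω))
    ((weakPartial_spec hu i).2.add hu.1 ((hφ.memLp 2).restrict Ω) (weakPartial_spec hu i).1
      (((hφ.pd i).memLp 2).restrict Ω) (hasWeakPartial_of_contDiff hφ.1))

theorem MemW0.add_testFun (hΩ : IsOpen Ω) (hu : MemW0 Ω u) (hφ : IsTestFun Ω φ) :
    MemW0 Ω (fun x => u x + φ x) := by
  refine ⟨hu.1.add hφ.memW, fun ε hε => ?_⟩
  obtain ⟨ψ, hψ, h1, h2⟩ := hu.2 ε hε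
  refine ⟨fun x => ψ x + φ x, hψ.add hφ, by simpa using h1, fun i => ?_⟩
  refine (eLpNorm_congr_ae ?_).trans_lt (h2 i)
  filter_upwards [weakPartial_add_ae_eq hΩ hu.1 hφ i] with x hx
  have := pd_add (i := i) hψ.1 hφ.1 x
  unfold pd at this hx
  rw [hx, this]
  ring

theorem abs_integral_mul_le_eLpNorm {α : Type*} [MeasurableSpace α] {μ : Measure α} {a b : α → ℝ}
    (ha : MemLp a 2 μ) (hb : MemLp b 2 μ) :
    |∫ x, a x * b x ∂μ| ≤ (eLpNorm a 2 μ).toReal * (eLpNorm b 2 μ).toReal := by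
  rw [← inner_toLp ha hb, ← Lp.norm_toLp a ha, ← Lp.norm_toLp b hb]
  exact abs_real_inner_le_norm _ _

/-- Functions in `W^{1,2}_0` can be integrated by parts without boundary terms. -/
theorem MemW0.integral_mul_pd (hw : MemW0 Ω w) (hψ : IsTestFun Ω' ψ) (i : Fin (m + 1)) :
    ∫ x in Ω, w x * pd i ψ x = - ∫ x in Ω, weakPartial Ω i w x * ψ x := by
  have hp := (weakPartial_spec hw.1 i).1
  rw [← sub_eq_zero, ← abs_nonpos_iff]
  refine le_of_forall_pos_le_add fun ε hε => ?_
  set A := (eLpNorm (pd i ψ) 2 (volume.restrict Ω)).toReal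
  set B := (eLpNorm ψ 2 (volume.restrict Ω)).toReal
  have hA : 0 ≤ A := ENNReal.toReal_nonneg
  have hB : 0 ≤ B := ENNReal.toReal_nonneg
  -- Approximating `w` in `W^{1,2}` within `η` by a test function costs at most `ηA + ηB` in the
  -- identity.
  set η := ε / (A + B + 1) with hη
  have hη0 : 0 < η := by positivity
  obtain ⟨φ, hφ, h1, h2⟩ := hw.2 (ENNReal.ofReal η) (ENNReal.ofReal_pos.2 hη0)
  have hwφ : MemLp (fun x => w x - φ x) 2 (volume.restrict Ω) :=
    hw.1.memLp.sub ((hφ.memLp 2).restrict Ω)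
  have hpφ : MemLp (fun x => weakPartial Ω i w x - pd i φ x) 2 (volume.restrict Ω) :=
    hp.sub (((hφ.pd i).memLp 2).restrict Ω)
  have e0 : ∫ x in Ω, φ x * pd i ψ x = - ∫ x in Ω, pd i φ x * ψ x := by
    have a1 := hφ.setIntegral_mul (pd i ψ)
    have a2 := (hφ.pd i).setIntegral_mul ψ
    simp_rw [mul_comm _ (φ _)] at a1
    simp_rw [mul_comm _ (pd i φ _)] at a2
    rw [a1, a2]
    exact _root_.integral_mul_pd hφ.1 hψ
  have e1 : (∫ x in Ω, w x * pd i ψ x) - - ∫ x in Ω, weakPartial Ω i w x * ψ x =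
      (∫ x in Ω, (w x - φ x) * pd i ψ x) +
        ∫ x in Ω, (weakPartial Ω i w x - pd i φ x) * ψ x := by
    simp only [sub_mul]
    rw [integral_sub ((hψ.pd i).integrable_mul_restrict hw.1.memLp)
        ((hψ.pd i).integrable_mul_restrict ((hφ.memLp 2).restrict Ω)),
      integral_sub (hψ.integrable_mul_restrict hp)
        (hψ.integrable_mul_restrict (((hφ.pd i).memLp 2).restrict Ω)), e0]
    ring
  have hle : ∀ {a : CylSpace m → ℝ}, eLpNorm a 2 (volume.restrict Ω) < ENNReal.ofReal η →
      (eLpNorm a 2 (volume.restrict Ω)).toReal ≤ η := fun h =>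
    ENNReal.toReal_le_of_le_ofReal hη0.le h.le
  rw [e1, zero_add]
  calc _ ≤ η * A + η * B := (abs_add_le _ _).trans (add_le_add
        ((abs_integral_mul_le_eLpNorm hwφ (((hψ.pd i).memLp 2).restrict Ω)).trans
          (mul_le_mul_of_nonneg_right (hle h1) hA))
        ((abs_integral_mul_le_eLpNorm hpφ ((hψ.memLp 2).restrict Ω)).trans
          (mul_le_mul_of_nonneg_right (hle (h2 i)) hB)))
    _ ≤ ε := by
      rw [← mul_add, hη, div_mul_eq_mul_div, div_le_iff₀ (by positivity)]
      nlinarith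

/-- Functions with zero trace on the flat faces can be integrated by parts without boundary terms
against test functions that need not vanish there. -/
theorem HasWeakPartial.integral_mul_pd_of_trace (hD : IsOpen D) (hDf : volume D ≠ ⊤)
    (hh : MemLp h 2 (volume.restrict (barrel D)))
    (hh' : MemLp h' 2 (volume.restrict (barrel D))) (hw : HasWeakPartial (barrel D) i h h')
    (hb : HasBottomTrace D h 0) (ht : HasTopTrace D h 0) (hψ : IsTestFun (D ×ˢ univ) ψ) :
    ∫ x in barrel D, h x * pd i ψ x = - ∫ x in barrel D, h' x * ψ x := by
  have i1 := (hψ.pd i).integrable_mul_restrict hh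
  have i2 := hψ.integrable_mul_restrict hh'
  have l1 := (tendsto_integral_axisCutoff_mul hD i1).add
    (tendsto_integral_mul_pd_axisCutoff_of_trace hD hDf hh hb ht hψ i)
  have l2 := (tendsto_integral_axisCutoff_mul hD i2).neg
  rw [add_zero] at l1
  refine tendsto_nhds_unique (l1.congr' ?_) l2
  filter_upwards [self_mem_nhdsWithin] with δ hδ
  have hχ := contDiff_comp_snd (m := m) (contDiff_axisCutoff δ)
  -- The cutoff makes `ψ` admissible in `barrel D`; the extra term with the derivative of the cutoff
  -- disappears in the limit because `h` has zero trace.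
  have h1 := hw _ (isTestFun_axisCutoff_mul hδ hψ)
  have e : ∀ x, h x * pd i (fun y => axisCutoff δ y.2 * ψ y) x =
      axisCutoff δ x.2 * (h x * pd i ψ x) +
        h x * (pd i (fun y => axisCutoff δ y.2) x * ψ x) := fun x => by
    rw [pd_mul hχ hψ.1]; ring
  change ∫ x in barrel D, h x * pd i (fun y => axisCutoff δ y.2 * ψ y) x = _ at h1
  simp_rw [e] at h1
  rw [integral_add] at h1
  · rw [h1]
    congr 2; ext x; ring
  · have := (hψ.pd i).mul_left hχ
    exact (this.integrable_mul_restrict hh).congr (ae_of_all _ fun x => by ring)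
  · exact (hψ.mul_left (hχ.pd i)).integrable_mul_restrict hh

/-- Weak solutions of the Poisson equation can be tested with functions vanishing on the flat
faces. -/
theorem sum_integral_mul_pd_of_faces (hD : IsOpen D) (hDf : volume D ≠ ⊤)
    (hG : ∀ i, MemLp (G i) 2 (volume.restrict (barrel D)))
    (hf : MemLp f 2 (volume.restrict (barrel D)))
    (hGf : ∀ φ, IsTestFun (barrel D) φ →
      ∑ i, ∫ x in barrel D, G i x * pd i φ x = - ∫ x in barrel D, f x * φ x)
    (hψ : IsTestFun (D ×ˢ univ) ψ) (h0 : ∀ x', ψ (x', 0) = 0) (h1 : ∀ x', ψ (x', 1) = 0) :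
    ∑ i, ∫ x in barrel D, G i x * pd i ψ x = - ∫ x in barrel D, f x * ψ x := by
  have hfin := isFiniteMeasure_restrict_barrel hDf
  -- No trace of `G i` is available, so the cutoff term is killed by the vanishing of `ψ` on the
  -- faces.
  have l1 := tendsto_finsetSum Finset.univ fun i _ =>
    (tendsto_integral_axisCutoff_mul hD ((hψ.pd i).integrable_mul_restrict (hG i))).add
      (tendsto_integral_mul_pd_axisCutoff hD ((hG i).integrable (by norm_num)) hψ h0 h1 i)
  have l2 := (tendsto_integral_axisCutoff_mul hD (hψ.integrable_mul_restrict hf)).neg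
  simp only [add_zero] at l1
  refine tendsto_nhds_unique (l1.congr' ?_) l2
  filter_upwards [self_mem_nhdsWithin] with δ hδ
  have hχ := contDiff_comp_snd (m := m) (contDiff_axisCutoff δ)
  have h1 := hGf _ (isTestFun_axisCutoff_mul hδ hψ)
  have e : ∀ x, f x * (axisCutoff δ x.2 * ψ x) = axisCutoff δ x.2 * (f x * ψ x) := fun x => by ring
  simp_rw [e] at h1
  rw [← h1]
  refine Finset.sum_congr rfl fun i _ => ?_
  rw [← integral_add]
  · congr 1; ext x
    rw [pd_mul hχ hψ.1]; ring
  · have := (hψ.pd i).mul_left hχ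
    exact (this.integrable_mul_restrict (hG i)).congr (ae_of_all _ fun x => by ring)
  · exact (hψ.mul_left (hχ.pd i)).integrable_mul_restrict (hG i)

/-- A functional on test functions that is bounded in `L²` is represented by an `L²` function. -/
theorem exists_memLp_of_testFun (T : (CylSpace m → ℝ) → ℝ) (C : ℝ)
    (hadd : ∀ φ ψ, IsTestFun Ω φ → IsTestFun Ω ψ → T (fun x => φ x + ψ x) = T φ + T ψ)
    (hmul : ∀ c φ, IsTestFun Ω φ → T (fun x => c * φ x) = c * T φ)
    (hT : ∀ φ, IsTestFun Ω φ → T φ ^ 2 ≤ C * ∫ x, φ x ^ 2) :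
    ∃ f, MemLp f 2 (volume.restrict Ω) ∧
      ∀ φ, IsTestFun Ω φ → T φ = ∫ x in Ω, f x * φ x := by
  obtain ⟨f, hf, h⟩ := exists_memLp_of_sq_le (μ := volume) (testSpace Ω)
    (fun φ hφ => IsTestFun.memLp hφ 2)
    { toFun := fun φ => T φ.1
      map_add' := fun φ ψ => hadd φ.1 ψ.1 φ.2 ψ.2
      map_smul' := fun c φ => hmul c φ.1 φ.2 } C fun φ => hT φ.1 φ.2
  exact ⟨f, hf.restrict Ω, fun φ hφ => (h ⟨φ, hφ⟩).trans (hφ.setIntegral_mul f).symm⟩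

end WeakPartial

/-! ### The first variation of the functional. -/

section Variation

variable {m : ℕ} {D : Set (EuclideanSpace ℝ (Fin m))} {Ω : Set (CylSpace m)}
  {g φ u : CylSpace m → ℝ} {i : Fin (m + 1)} {t : ℝ}

theorem isOpen_barrel (hD : IsOpen D) : IsOpen (barrel D) := hD.prod isOpen_Ioo

theorem IsTestFun.integrable_slice (hφ : IsTestFun Ω φ) (x' : EuclideanSpace ℝ (Fin m)) :
    Integrable (fun s => φ (x', s)) (volume.restrict (Ioo (0 : ℝ) 1)) := by
  have h : Continuous fun s => φ (x', s) := hφ.1.continuous.comp (by fun_prop)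
  exact (h.integrableOn_Icc (a := 0) (b := 1)).mono_set Ioo_subset_Icc_self

theorem max_axisMean_add_le (hφ : IsTestFun Ω φ) (x' : EuclideanSpace ℝ (Fin m)) :
    max (axisMean (fun x => u x + t * φ x) x') 0 ≤
      max (axisMean u x') 0 + |t| * ∫ s in Ioo (0 : ℝ) 1, |φ (x', s)| := by
  have hφi := (hφ.integrable_slice x').const_mul t
  have hN : 0 ≤ ∫ s in Ioo (0 : ℝ) 1, |φ (x', s)| := integral_nonneg fun _ => abs_nonneg _
  have hN' : 0 ≤ |t| * ∫ s in Ioo (0 : ℝ) 1, |φ (x', s)| := mul_nonneg (abs_nonneg _) hN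
  by_cases hu : Integrable (fun s => u (x', s)) (volume.restrict (Ioo (0 : ℝ) 1))
  · have h1 : axisMean (fun x => u x + t * φ x) x' =
        axisMean u x' + t * ∫ s in Ioo (0 : ℝ) 1, φ (x', s) := by
      unfold axisMean
      rw [integral_add hu hφi, integral_const_mul]
    have h2 : t * ∫ s in Ioo (0 : ℝ) 1, φ (x', s) ≤ |t| * ∫ s in Ioo (0 : ℝ) 1, |φ (x', s)| := by
      refine (le_abs_self _).trans ?_
      rw [abs_mul]
      gcongr
      exact abs_integral_le_integral_abs
    rw [h1]
    refine max_le ?_ (add_nonneg (le_max_right _ _) hN')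
    linarith [le_max_left (axisMean u x') 0]
  -- On a slice where `u` is not integrable, neither is `u + tφ`, so the mean takes its default
  -- value `0` and the bound still holds. It is thus valid for every `x'`.
  · have h1 : axisMean (fun x => u x + t * φ x) x' = 0 := integral_undef fun h => hu <| by
      refine (h.sub hφi).congr (ae_of_all _ fun s => ?_)
      simp
    rw [h1, max_self]
    exact add_nonneg (le_max_right _ _) hN'

theorem lintegral_axisMean_add_le (hφ : IsTestFun Ω φ) :
    ∫⁻ x' in D, ENNReal.ofReal (max (axisMean (fun x => u x + t * φ x) x') 0) ≤
      (∫⁻ x' in D, ENNReal.ofReal (max (axisMean u x') 0)) +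
        ENNReal.ofReal (|t| * ∫ x in barrel D, |φ x|) := by
  have hi : Integrable (fun x => |φ x|)
      ((volume.restrict D).prod (volume.restrict (Ioo (0 : ℝ) 1))) := by
    rw [Measure.prod_restrict]
    exact hφ.integrable.abs.restrict
  have hi' := hi.integral_prod_left.const_mul |t|
  have hprod : ∫ x in barrel D, |φ x| = ∫ x' in D, ∫ s in Ioo (0 : ℝ) 1, |φ (x', s)| := by
    rw [← integral_prod _ hi, Measure.prod_restrict]
    rfl
  rw [hprod, ← integral_const_mul, ofReal_integral_eq_lintegral_ofReal hi'
    (ae_of_all _ fun x' => mul_nonneg (abs_nonneg _) (integral_nonneg fun _ => abs_nonneg _)),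
    -- Only the `φ` summand has to be measurable, so measurability of the axial mean of `u` is never
    -- used.
    ← lintegral_add_right' _ hi'.1.aemeasurable.ennreal_ofReal]
  refine lintegral_mono fun x' => ?_
  exact (ENNReal.ofReal_le_ofReal (max_axisMean_add_le hφ x')).trans ENNReal.ofReal_add_le

theorem lintegral_weakPartial_add (hΩ : IsOpen Ω) (hu : MemW Ω 1 u) (hφ : IsTestFun Ω φ) (t : ℝ) :
    ∫⁻ x in Ω, ENNReal.ofReal (∑ i, weakPartial Ω i (fun x => u x + t * φ x) x ^ 2) =
      ENNReal.ofReal ((∑ i, ∫ x in Ω, weakPartial Ω i u x ^ 2) +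
        2 * t * (∑ i, ∫ x in Ω, weakPartial Ω i u x * pd i φ x) +
        t ^ 2 * ∑ i, ∫ x in Ω, pd i φ x ^ 2) := by
  have hq := fun i => (weakPartial_spec hu i).1
  have hp : ∀ i, MemLp (pd i φ) 2 (volume.restrict Ω) := fun i => ((hφ.pd i).memLp 2).restrict Ω
  have hae : ∀ᵐ x ∂(volume.restrict Ω), ∀ i, weakPartial Ω i (fun x => u x + t * φ x) x =
      weakPartial Ω i u x + t * pd i φ x := by
    refine ae_all_iff.2 fun i => ?_
    filter_upwards [weakPartial_add_ae_eq hΩ hu (hφ.const_mul t) i] with x hx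
    rw [hx, pd_const_mul hφ.1]
  have hsq : ∀ i, Integrable (fun x => (weakPartial Ω i u x + t * pd i φ x) ^ 2)
      (volume.restrict Ω) := fun i => ((hq i).add ((hp i).const_mul t)).integrable_sq
  have h1 : ∫⁻ x in Ω, ENNReal.ofReal (∑ i, weakPartial Ω i (fun x => u x + t * φ x) x ^ 2) =
      ∫⁻ x in Ω, ENNReal.ofReal (∑ i, (weakPartial Ω i u x + t * pd i φ x) ^ 2) := by
    refine lintegral_congr_ae ?_
    filter_upwards [hae] with x hx
    simp only [hx]
  rw [h1, ← ofReal_integral_eq_lintegral_ofReal (integrable_finsetSum _ fun i _ => hsq i)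
    (ae_of_all _ fun x => Finset.sum_nonneg fun i _ => sq_nonneg _),
    integral_finsetSum _ fun i _ => hsq i, Finset.mul_sum, Finset.mul_sum,
    ← Finset.sum_add_distrib, ← Finset.sum_add_distrib]
  congr 1
  refine Finset.sum_congr rfl fun i _ => ?_
  have i2 : Integrable (fun x => 2 * t * (weakPartial Ω i u x * pd i φ x)) (volume.restrict Ω) :=
    ((hq i).integrable_mul (hp i)).const_mul _
  have i12 : Integrable (fun x => weakPartial Ω i u x ^ 2 +
      2 * t * (weakPartial Ω i u x * pd i φ x)) (volume.restrict Ω) := (hq i).integrable_sq.add i2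
  rw [← integral_const_mul, ← integral_const_mul, ← integral_add (hq i).integrable_sq i2,
    ← integral_add i12 ((hp i).integrable_sq.const_mul _)]
  congr 1; ext x; ring

/-- The first variation of the obstacle functional at a minimizer. -/
theorem IsMinimizerJ.abs_sum_integral_le (hD : IsOpen D) (hu : IsMinimizerJ D g u)
    (hφ : IsTestFun (barrel D) φ) :
    |∑ i, ∫ x in barrel D, weakPartial (barrel D) i u x * pd i φ x| ≤
      ∫ x in barrel D, |φ x| := by
  obtain ⟨huW, hug, hfin, hmin⟩ := hu
  set A := ∑ i, ∫ x in barrel D, weakPartial (barrel D) i u x ^ 2 with hA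
  set L := ∑ i, ∫ x in barrel D, weakPartial (barrel D) i u x * pd i φ x with hL
  set E := ∑ i, ∫ x in barrel D, pd i φ x ^ 2 with hE
  set N := ∫ x in barrel D, |φ x| with hN
  have hN0 : 0 ≤ N := integral_nonneg fun _ => abs_nonneg _
  have hA0 : 0 ≤ A := Finset.sum_nonneg fun i _ => integral_nonneg fun _ => sq_nonneg _
  have hE0 : 0 ≤ E := Finset.sum_nonneg fun i _ => integral_nonneg fun _ => sq_nonneg _
  -- Comparison of `u` with `u + tφ`: the Dirichlet part changes by `2tL + t²E`, the penalty
  -- increases by at most `2|t|N`. The finiteness of `J(u)` allows the common penalty term to be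
  -- cancelled in `[0, ∞]`.
  have key : ∀ t : ℝ, 0 ≤ 2 * t * L + t ^ 2 * E + 2 * (|t| * N) := by
    intro t
    have hJ := hmin (fun x => u x + t * φ x) (huW.add (hφ.const_mul t).memW) (by
      have := hug.add_testFun (isOpen_barrel hD) (hφ.const_mul t)
      convert this using 2
      ring)
    have hJu : obstacleJ D u = ENNReal.ofReal A +
        2 * ∫⁻ x' in D, ENNReal.ofReal (max (axisMean u x') 0) := by
      have := lintegral_weakPartial_add (isOpen_barrel hD) huW hφ 0
      simp only [zero_mul, add_zero, mul_zero, ne_eq, OfNat.ofNat_ne_zero, not_false_eq_true,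
        zero_pow] at this
      rw [obstacleJ, this]
    have hB : 2 * ∫⁻ x' in D, ENNReal.ofReal (max (axisMean u x') 0) ≠ ⊤ := fun h =>
      hfin (by rw [hJu, h, add_top])
    have hJw : obstacleJ D (fun x => u x + t * φ x) ≤
        ENNReal.ofReal (A + 2 * t * L + t ^ 2 * E) +
        (ENNReal.ofReal (2 * (|t| * N)) +
          2 * ∫⁻ x' in D, ENNReal.ofReal (max (axisMean u x') 0)) := by
      rw [obstacleJ, lintegral_weakPartial_add (isOpen_barrel hD) huW hφ t]
      gcongr
      rw [ENNReal.ofReal_mul zero_le_two, ENNReal.ofReal_ofNat, ← mul_add, add_comm]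
      gcongr
      exact lintegral_axisMean_add_le hφ
    have h1 := hJ.trans hJw
    rw [hJu, ← add_assoc, ENNReal.add_le_add_iff_right hB] at h1
    -- Needed because `ENNReal.ofReal` truncates at zero; it follows from Cauchy–Schwarz in each
    -- direction.
    have hnn : 0 ≤ A + 2 * t * L + t ^ 2 * E := by
      rw [hA, hL, hE, Finset.mul_sum, Finset.mul_sum, ← Finset.sum_add_distrib,
        ← Finset.sum_add_distrib]
      refine Finset.sum_nonneg fun i _ => ?_
      have hcs := sq_integral_mul_le (weakPartial_spec huW i).1
        (((hφ.pd i).memLp 2).restrict (barrel D))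
      have ha : 0 ≤ ∫ x in barrel D, weakPartial (barrel D) i u x ^ 2 :=
        integral_nonneg fun _ => sq_nonneg _
      have hb : 0 ≤ ∫ x in barrel D, pd i φ x ^ 2 := integral_nonneg fun _ => sq_nonneg _
      set a := ∫ x in barrel D, weakPartial (barrel D) i u x ^ 2
      set b := ∫ x in barrel D, pd i φ x ^ 2
      set c := ∫ x in barrel D, weakPartial (barrel D) i u x * pd i φ x
      have h1 : |t * c| ≤ √a * √(t ^ 2 * b) := by
        rw [← Real.sqrt_mul ha]
        apply Real.abs_le_sqrt
        nlinarith [mul_le_mul_of_nonneg_left hcs (sq_nonneg t)]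
      have h2 := Real.sq_sqrt ha
      have h3 := Real.sq_sqrt (mul_nonneg (sq_nonneg t) hb)
      nlinarith [sq_nonneg (√a - √(t ^ 2 * b)), neg_abs_le (t * c)]
    rw [← ENNReal.ofReal_add hnn (by positivity), ENNReal.ofReal_le_ofReal_iff (by positivity)]
      at h1
    linarith
  -- Division of `key` at `t = rs` by `r > 0`, with `r` so small that `rE ≤ ε`; the signs `s = ±1`
  -- give the two halves of the absolute value.
  have hlim : ∀ s : ℝ, |s| = 1 → -(s * L) ≤ N := by
    intro s hs
    refine le_of_forall_pos_le_add fun ε hε => ?_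
    set r := ε / (E + 1) with hr
    have hr0 : 0 < r := by positivity
    have h1 := key (r * s)
    have hs2 : s ^ 2 = 1 := by rw [← sq_abs, hs, one_pow]
    rw [abs_mul, hs, abs_of_pos hr0, mul_pow, hs2] at h1
    have h2 : 0 ≤ r * (2 * (s * L) + r * E + 2 * N) := by linarith
    have h3 := nonneg_of_mul_nonneg_right h2 hr0
    have h4 : r * E ≤ ε := by
      rw [hr, div_mul_eq_mul_div, div_le_iff₀ (by positivity)]
      nlinarith
    linarith
  rw [abs_le]
  constructor
  · linarith [hlim 1 (by simp)]
  · linarith [hlim (-1) (by simp)]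

end Variation

/-! ### The equation and the boundary conditions for a minimizer minus the interpolation. -/

section Assembly

variable {m : ℕ} {D D' : Set (EuclideanSpace ℝ (Fin m))} {g φ ψ u : CylSpace m → ℝ}

theorem memLp_restrict_barrel (hDc : IsCompact (closure D)) {f : CylSpace m → ℝ}
    (hf : Continuous f) : MemLp f 2 (volume.restrict (barrel D)) := by
  have hfin := isFiniteMeasure_restrict_barrel
    ((measure_mono subset_closure).trans_lt hDc.measure_lt_top).ne
  have hK : IsCompact (closure D ×ˢ Icc (0 : ℝ) 1) := hDc.prod isCompact_Icc
  obtain ⟨C, hC⟩ := hK.exists_bound_of_continuousOn hf.continuousOn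
  have hsub : barrel D ⊆ closure D ×ˢ Icc (0 : ℝ) 1 := prod_mono subset_closure Ioo_subset_Icc_self
  refine MemLp.of_bound hf.aestronglyMeasurable C ?_
  exact ae_restrict_of_ae_restrict_of_subset hsub
    ((ae_restrict_iff' hK.measurableSet).2 (ae_of_all _ hC))

/-- A smooth function of the axial variable that is equal to `α` near `0` and to `β` near `1`. -/
def axisInterp (α β t : ℝ) : ℝ := α + (β - α) * Real.smoothTransition (3 * t - 1)

theorem contDiff_axisInterp (α β : ℝ) : ContDiff ℝ ∞ (axisInterp α β) :=
  contDiff_const.add (contDiff_const.mul (Real.smoothTransition.contDiff.comp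
    ((contDiff_const.mul contDiff_id).sub contDiff_const)))

theorem axisInterp_of_le {α β t : ℝ} (ht : t ≤ 1 / 3) : axisInterp α β t = α := by
  rw [axisInterp, Real.smoothTransition.zero_of_nonpos (by linarith)]; ring

theorem axisInterp_of_ge {α β t : ℝ} (ht : 2 / 3 ≤ t) : axisInterp α β t = β := by
  rw [axisInterp, Real.smoothTransition.one_of_one_le (by linarith)]; ring

/-- The interpolation equals `α` on the layers of thickness `δ < 1/3`, so the trace integrand is
literally unchanged; passing to `D'` only decreases the integral. -/
theorem HasBottomTrace.sub_axisInterp {α : ℝ} (h : HasBottomTrace D g fun _ => α) (hD' : IsOpen D')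
    (hDD' : D' ⊆ D) (β : ℝ) : HasBottomTrace D' (fun x => g x - axisInterp α β x.2) 0 := by
  unfold HasBottomTrace at h ⊢
  refine tendsto_of_tendsto_of_tendsto_of_le_of_le' (g := fun _ => (0 : ℝ≥0∞))
    tendsto_const_nhds h (Eventually.of_forall fun _ => zero_le) ?_
  filter_upwards [Ioo_mem_nhdsGT (show (0 : ℝ) < 1 / 3 by norm_num)] with δ hδ
  refine mul_le_mul_right ?_ _
  refine (setLIntegral_congr_fun
    (hD'.prod (isOpen_Ioo (a := (0 : ℝ)) (b := δ))).measurableSet fun x hx => ?_).trans_le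
    (lintegral_mono_set (prod_mono_left hDD'))
  have h2 : x.2 ∈ Ioo (0 : ℝ) δ := hx.2
  simp only [Pi.zero_apply, sub_zero]
  rw [axisInterp_of_le (by linarith [h2.2, hδ.2])]

theorem HasTopTrace.sub_axisInterp {β : ℝ} (h : HasTopTrace D g fun _ => β) (hD' : IsOpen D')
    (hDD' : D' ⊆ D) (α : ℝ) : HasTopTrace D' (fun x => g x - axisInterp α β x.2) 0 := by
  unfold HasTopTrace at h ⊢
  refine tendsto_of_tendsto_of_tendsto_of_le_of_le' (g := fun _ => (0 : ℝ≥0∞))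
    tendsto_const_nhds h (Eventually.of_forall fun _ => zero_le) ?_
  filter_upwards [Ioo_mem_nhdsGT (show (0 : ℝ) < 1 / 3 by norm_num)] with δ hδ
  refine mul_le_mul_right ?_ _
  refine (setLIntegral_congr_fun
    (hD'.prod (isOpen_Ioo (a := 1 - δ) (b := (1 : ℝ)))).measurableSet fun x hx => ?_).trans_le
    (lintegral_mono_set (prod_mono_left hDD'))
  have h2 : x.2 ∈ Ioo (1 - δ) (1 : ℝ) := hx.2
  simp only [Pi.zero_apply, sub_zero]
  rw [axisInterp_of_ge (by linarith [h2.1, hδ.2])]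

theorem IsTestFun.setIntegral_barrel_mul (hψ : IsTestFun (D' ×ˢ univ) ψ) (hD : IsOpen D)
    (hDD' : D' ⊆ D) (f : CylSpace m → ℝ) :
    ∫ x in barrel D', f x * ψ x = ∫ x in barrel D, f x * ψ x := by
  symm
  refine setIntegral_eq_of_subset_of_forall_sdiff_eq_zero (measurableSet_barrel hD)
    (prod_mono_left hDD') fun x hx => ?_
  rw [image_eq_zero_of_notMem_tsupport fun h => hx.2 ⟨(hψ.2.2 h).1, hx.1.2⟩, mul_zero]

theorem barrel_subset_prod_univ : barrel D ⊆ D ×ˢ univ := prod_mono_right (subset_univ _)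

/-- The Euler–Lagrange equation: on a subcylinder, the Laplacian of a minimizer is square
integrable. -/
theorem IsMinimizerJ.exists_weak_laplacian (hD : IsOpen D) (hu : IsMinimizerJ D g u)
    (hD'f : volume D' ≠ ⊤) (hDD' : D' ⊆ D) :
    ∃ f, MemLp f 2 (volume.restrict (barrel D')) ∧ ∀ φ, IsTestFun (barrel D') φ →
      ∑ i, ∫ x in barrel D', weakPartial (barrel D) i u x * pd i φ x =
        - ∫ x in barrel D', f x * φ x := by
  have hfin := isFiniteMeasure_restrict_barrel hD'f
  have hsub : barrel D' ⊆ barrel D := prod_mono_left hDD'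
  have hq : ∀ i, MemLp (weakPartial (barrel D) i u) 2 (volume.restrict (barrel D')) := fun i =>
    (weakPartial_spec hu.1 i).1.mono_measure (Measure.restrict_mono_set _ hsub)
  obtain ⟨f, hf, h⟩ := exists_memLp_of_testFun (Ω := barrel D')
    (fun φ => ∑ i, ∫ x in barrel D', weakPartial (barrel D) i u x * pd i φ x)
    ((volume.restrict (barrel D')).real univ)
    (fun φ ψ hφ hψ => by
      rw [← Finset.sum_add_distrib]
      refine Finset.sum_congr rfl fun i _ => ?_
      rw [← integral_add ((hφ.pd i).integrable_mul_restrict (hq i))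
        ((hψ.pd i).integrable_mul_restrict (hq i))]
      simp_rw [pd_add hφ.1 hψ.1, mul_add])
    (fun c φ hφ => by
      rw [Finset.mul_sum]
      refine Finset.sum_congr rfl fun i _ => ?_
      rw [← integral_const_mul]
      simp_rw [pd_const_mul hφ.1, mul_left_comm])
    (fun φ hφ => by
      have h1 := hu.abs_sum_integral_le hD (hφ.mono hsub)
      have h2 : ∀ i, ∫ x in barrel D', weakPartial (barrel D) i u x * pd i φ x =
          ∫ x in barrel D, weakPartial (barrel D) i u x * pd i φ x := fun i =>
        ((hφ.mono barrel_subset_prod_univ).pd i).setIntegral_barrel_mul hD hDD' _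
      have h3 : ∫ x in barrel D, |φ x| = ∫ x in barrel D', 1 * |φ x| := by
        simp_rw [one_mul]
        refine setIntegral_eq_of_subset_of_forall_sdiff_eq_zero (measurableSet_barrel hD) hsub
          fun x hx => ?_
        rw [image_eq_zero_of_notMem_tsupport fun h => hx.2 (hφ.2.2 h), abs_zero]
      -- Cauchy–Schwarz against the constant `1` turns the `L¹` bound into an `L²` bound whose
      -- constant is the volume of `barrel D'`.
      have h4 := sq_integral_mul_le (μ := volume.restrict (barrel D')) (memLp_const (1 : ℝ))
        ((hφ.memLp 2).restrict _).abs
      simp only [h2]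
      rw [← sq_abs]
      refine (pow_le_pow_left₀ (abs_nonneg _) h1 2).trans ?_
      rw [h3]
      refine h4.trans ?_
      simp only [Pi.abs_apply, sq_abs, one_pow, integral_const, smul_eq_mul, mul_one]
      refine mul_le_mul_of_nonneg_left ?_ measureReal_nonneg
      exact setIntegral_le_integral (((hφ.memLp 2)).integrable_sq)
        (ae_of_all _ fun x => sq_nonneg _))
  refine ⟨fun x => - f x, hf.neg, fun φ hφ => ?_⟩
  rw [h φ hφ]
  simp only [neg_mul, integral_neg, neg_neg]

/-- The difference of a minimizer and a smooth interpolation of its constant boundary values on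
the flat faces can be integrated by parts without boundary terms there. -/
theorem IsMinimizerJ.integral_sub_mul_pd (hD : IsOpen D) (hg : MemW (barrel D) 1 g) {α β : ℝ}
    (hg_bottom : HasBottomTrace D g fun _ => α) (hg_top : HasTopTrace D g fun _ => β)
    (hu : IsMinimizerJ D g u) (hD' : IsOpen D') (hD'c : IsCompact (closure D'))
    (hDD' : D' ⊆ D) (hψ : IsTestFun (D' ×ˢ univ) ψ) (i : Fin (m + 1)) :
    ∫ x in barrel D', (u x - axisInterp α β x.2) * pd i ψ x =
      - ∫ x in barrel D', (weakPartial (barrel D) i u x -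
        pd i (fun y => axisInterp α β y.2) x) * ψ x := by
  have hsub : barrel D' ⊆ barrel D := prod_mono_left hDD'
  have hmono : ∀ {f : CylSpace m → ℝ}, MemLp f 2 (volume.restrict (barrel D)) →
      MemLp f 2 (volume.restrict (barrel D')) := fun h =>
    h.mono_measure (Measure.restrict_mono_set _ hsub)
  have hD'f : volume D' ≠ ⊤ := ((measure_mono subset_closure).trans_lt hD'c.measure_lt_top).ne
  have hG : ContDiff ℝ ∞ (fun y : CylSpace m => axisInterp α β y.2) :=
    contDiff_comp_snd (contDiff_axisInterp α β)
  have hGm := memLp_restrict_barrel hD'c hG.continuous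
  have hGm' := memLp_restrict_barrel hD'c (hG.pd i).continuous
  obtain ⟨huW, hug, -, -⟩ := hu
  have hug' := (weakPartial_spec hug.1 i)
  have hg' := (weakPartial_spec hg i)
  have e1 : ∫ x in barrel D', (u x - g x) * pd i ψ x =
      - ∫ x in barrel D', weakPartial (barrel D) i (fun x => u x - g x) x * ψ x := by
    -- Membership of `u - g` in `W^{1,2}_0` is known only on the whole of `barrel D`, so the
    -- integrals are first enlarged to it; `ψ` vanishes over `D` outside `D'`.
    rw [(hψ.pd i).setIntegral_barrel_mul hD hDD', hψ.setIntegral_barrel_mul hD hDD']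
    exact hug.integral_mul_pd hψ i
  have e2 : ∫ x in barrel D', (g x - axisInterp α β x.2) * pd i ψ x =
      - ∫ x in barrel D', (weakPartial (barrel D) i g x -
        pd i (fun y => axisInterp α β y.2) x) * ψ x :=
    HasWeakPartial.integral_mul_pd_of_trace hD' hD'f ((hmono hg.1).sub hGm)
      ((hmono hg'.1).sub hGm')
      ((hg'.2.mono hsub).sub (hmono hg.1) hGm (hmono hg'.1) hGm' (hasWeakPartial_of_contDiff hG))
      (hg_bottom.sub_axisInterp hD' hDD' β) (hg_top.sub_axisInterp hD' hDD' α) hψ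
  have hae : ∀ᵐ x ∂(volume.restrict (barrel D')), weakPartial (barrel D) i u x =
      weakPartial (barrel D) i (fun x => u x - g x) x + weakPartial (barrel D) i g x := by
    refine ae_restrict_of_ae_restrict_of_subset hsub ?_
    refine weakPartial_ae_eq (isOpen_barrel hD) huW (hug'.1.add hg'.1) ?_
    have := hug'.2.add hug.1.1 hg.1 hug'.1 hg'.1 hg'.2
    simpa only [sub_add_cancel] using this
  have hgG : MemLp (fun x => g x - axisInterp α β x.2) 2 (volume.restrict (barrel D')) :=
    (hmono hg.1).sub hGm
  have hgG' : MemLp (fun x => weakPartial (barrel D) i g x -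
      pd i (fun y => axisInterp α β y.2) x) 2 (volume.restrict (barrel D')) :=
    (hmono hg'.1).sub hGm'
  have e3 : ∫ x in barrel D', (u x - axisInterp α β x.2) * pd i ψ x =
      (∫ x in barrel D', (u x - g x) * pd i ψ x) +
        ∫ x in barrel D', (g x - axisInterp α β x.2) * pd i ψ x := by
    rw [← integral_add ((hψ.pd i).integrable_mul_restrict (hmono hug.1.1))
      ((hψ.pd i).integrable_mul_restrict hgG)]
    congr 1; ext x; ring
  have e4 : ∫ x in barrel D', (weakPartial (barrel D) i u x -
        pd i (fun y => axisInterp α β y.2) x) * ψ x =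
      (∫ x in barrel D', weakPartial (barrel D) i (fun x => u x - g x) x * ψ x) +
      ∫ x in barrel D', (weakPartial (barrel D) i g x -
        pd i (fun y => axisInterp α β y.2) x) * ψ x := by
    rw [← integral_add (hψ.integrable_mul_restrict (hmono hug'.1))
      (hψ.integrable_mul_restrict hgG')]
    refine integral_congr_ae ?_
    filter_upwards [hae] with x hx
    simp only [hx]
    ring
  rw [e3, e1, e2, e4, neg_add]

/-- The second order estimate, in dual form, for a minimizer with smooth boundary values on the
flat faces subtracted. -/
theorem IsMinimizerJ.exists_sq_integral_le (hD : IsOpen D) (hg : MemW (barrel D) 1 g) {α β : ℝ}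
    (hg_bottom : HasBottomTrace D g fun _ => α) (hg_top : HasTopTrace D g fun _ => β)
    (hu : IsMinimizerJ D g u) (hD'c : IsCompact (closure D')) (hDD' : closure D' ⊆ D) :
    ∃ C : ℝ, ∀ φ, IsTestFun (barrel D') φ → ∀ i j,
      (∫ x in barrel D', (u x - axisInterp α β x.2) * pd i (pd j φ) x) ^ 2 ≤
        C * ∫ x, φ x ^ 2 := by
  -- `D` may have infinite measure; the intermediate `V` has finite measure and still leaves room
  -- for the lateral cutoff around `D'`.
  obtain ⟨V, hV, hD'V, hVD, hVc⟩ := exists_open_between_and_isCompact_closure hD'c hD hDD'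
  have hVf : volume V ≠ ⊤ := ((measure_mono subset_closure).trans_lt hVc.measure_lt_top).ne
  have hVD' : V ⊆ D := subset_closure.trans hVD
  have hsub : barrel V ⊆ barrel D := prod_mono_left hVD'
  have hm := measurableSet_barrel hV
  obtain ⟨f, hf, hEL⟩ := hu.exists_weak_laplacian hD hVf hVD'
  have hG : ContDiff ℝ ∞ (fun y : CylSpace m => axisInterp α β y.2) :=
    contDiff_comp_snd (contDiff_axisInterp α β)
  set G := fun y : CylSpace m => axisInterp α β y.2 with hGdef
  have hU : MemLp (fun x => u x - G x) 2 (volume.restrict (barrel V)) :=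
    (hu.1.1.mono_measure (Measure.restrict_mono_set _ hsub)).sub
      (memLp_restrict_barrel hVc hG.continuous)
  have hq : ∀ i, MemLp (weakPartial (barrel D) i u) 2 (volume.restrict (barrel V)) := fun i =>
    (weakPartial_spec hu.1 i).1.mono_measure (Measure.restrict_mono_set _ hsub)
  have hGi := fun i => memLp_restrict_barrel hVc (hG.pd i).continuous
  have hGl := memLp_restrict_barrel hVc hG.lap.continuous
  have hEL' : ∀ φ, IsTestFun (barrel V) φ →
      ∑ i, ∫ x in barrel V, (weakPartial (barrel D) i u x - pd i G x) * pd i φ x =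
        - ∫ x in barrel V, (f x - lap G x) * φ x := by
    intro φ hφ
    have h1 : ∀ i, ∫ x in barrel V, (weakPartial (barrel D) i u x - pd i G x) * pd i φ x =
        (∫ x in barrel V, weakPartial (barrel D) i u x * pd i φ x) +
          ∫ x in barrel V, pd i (pd i G) x * φ x := by
      intro i
      have h2 := hasWeakPartial_of_contDiff (Ω := barrel V) (i := i) (hG.pd i) φ hφ
      rw [← neg_eq_iff_eq_neg] at h2
      rw [← h2, ← sub_eq_add_neg]
      simp only [sub_mul]
      exact integral_sub ((hφ.pd i).integrable_mul_restrict (hq i))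
        ((hφ.pd i).integrable_mul_restrict (hGi i))
    have h3 : ∑ i, ∫ x in barrel V, pd i (pd i G) x * φ x = ∫ x in barrel V, lap G x * φ x := by
      simp only [lap, Finset.sum_mul]
      rw [integral_finsetSum]
      exact fun i _ => hφ.integrable_mul_restrict
        (memLp_restrict_barrel hVc ((hG.pd i).pd i).continuous)
    simp only [h1]
    rw [Finset.sum_add_distrib, hEL φ hφ, h3]
    simp only [sub_mul]
    rw [integral_sub (hφ.integrable_mul_restrict hf) (hφ.integrable_mul_restrict hGl)]
    ring
  have hind : ∀ {f : CylSpace m → ℝ}, MemLp f 2 (volume.restrict (barrel V)) →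
      MemLp ((barrel V).indicator f) 2 volume := fun h => (memLp_indicator_iff_restrict hm).2 h
  obtain ⟨C, hC⟩ := exists_sq_integral_mul_pd_pd_le_of_cylinder hV hD'c hD'V
    (U := (barrel V).indicator fun x => u x - G x)
    (G := fun i => (barrel V).indicator fun x => weakPartial (barrel D) i u x - pd i G x)
    (f := (barrel V).indicator fun x => f x - lap G x)
    (hind hU) (fun i => hind ((hq i).sub (hGi i))) (hind (hf.sub hGl))
    (fun x hx => indicator_of_notMem (fun h => hx h.2) _)
    (fun i φ hφ => by
      rw [integral_indicator_mul hm, integral_indicator_mul hm]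
      exact hu.integral_sub_mul_pd hD hg hg_bottom hg_top hV hVc hVD' hφ i)
    (fun φ hφ h0 h1 => by
      simp only [integral_indicator_mul hm]
      exact sum_integral_mul_pd_of_faces hV hVf (fun i => (hq i).sub (hGi i)) (hf.sub hGl)
        hEL' hφ h0 h1)
  refine ⟨C, fun φ hφ i j => ?_⟩
  have h := hC φ hφ i j
  rw [integral_indicator_mul hm, ← (((hφ.mono barrel_subset_prod_univ).pd j).pd
    i).setIntegral_barrel_mul hV (subset_closure.trans hD'V)] at h
  exact h

end Assembly

end

theorem corollary4p1 {m : ℕ} (D : Set (EuclideanSpace ℝ (Fin m))) (hD : IsOpen D)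
    (g : CylSpace m → ℝ) (hg : MemW (barrel D) 1 g)
    (α β : ℝ) (hg_bottom : HasBottomTrace D g (fun _ => α))
    (hg_top : HasTopTrace D g (fun _ => β))
    (u : CylSpace m → ℝ) (hu : IsMinimizerJ D g u) :
    ∀ D' : Set (EuclideanSpace ℝ (Fin m)), IsOpen D' → IsCompact (closure D') →
      closure D' ⊆ D → MemW (barrel D') 2 u := by
  intro D' hD' hD'c hDD'
  have hsub : barrel D' ⊆ barrel D := prod_mono_left (subset_closure.trans hDD')
  have hmono : ∀ {f : CylSpace m → ℝ}, MemLp f 2 (volume.restrict (barrel D)) →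
      MemLp f 2 (volume.restrict (barrel D')) := fun h =>
    h.mono_measure (Measure.restrict_mono_set _ hsub)
  obtain ⟨C, hC⟩ := hu.exists_sq_integral_le hD hg hg_bottom hg_top hD'c hDD'
  have hG : ContDiff ℝ ∞ (fun y : CylSpace m => axisInterp α β y.2) :=
    contDiff_comp_snd (contDiff_axisInterp α β)
  set G := fun y : CylSpace m => axisInterp α β y.2 with hGdef
  have hGm := memLp_restrict_barrel hD'c hG.continuous
  have hU : MemLp (fun x => u x - G x) 2 (volume.restrict (barrel D')) := (hmono hu.1.1).sub hGm
  refine ⟨hmono hu.1.1, fun i => ⟨weakPartial (barrel D) i u, ⟨?_, fun j => ?_⟩,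
    (weakPartial_spec hu.1 i).2.mono hsub⟩⟩
  · exact hmono (weakPartial_spec hu.1 i).1
  -- Riesz representation converts the dual bound into the second weak derivative `f` of `u - G`;
  -- the smooth second derivative of `G` is added back afterwards.
  · obtain ⟨f, hf, h⟩ := exists_memLp_of_testFun (Ω := barrel D')
      (fun φ => ∫ x in barrel D', (u x - G x) * pd i (pd j φ) x) C
      (fun φ ψ hφ hψ => by
        rw [← integral_add (((hφ.pd j).pd i).integrable_mul_restrict hU)
          (((hψ.pd j).pd i).integrable_mul_restrict hU)]
        congr 1; ext x
        rw [show pd j (fun x => φ x + ψ x) = fun x => pd j φ x + pd j ψ x from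
          funext fun x => pd_add hφ.1 hψ.1 x, pd_add (hφ.1.pd j) (hψ.1.pd j), mul_add])
      (fun c φ hφ => by
        rw [← integral_const_mul]
        congr 1; ext x
        rw [show pd j (fun x => c * φ x) = fun x => c * pd j φ x from
          funext fun x => pd_const_mul hφ.1 c x, pd_const_mul (hφ.1.pd j), mul_left_comm])
      (fun φ hφ => hC φ hφ i j)
    have hGij : MemLp (pd j (pd i G)) 2 (volume.restrict (barrel D')) :=
      memLp_restrict_barrel hD'c ((hG.pd i).pd j).continuous
    refine ⟨fun x => f x + pd j (pd i G) x, hf.add hGij, fun φ hφ => ?_⟩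
    have h1 : ∫ x in barrel D', u x * pd i (pd j φ) x =
        - ∫ x in barrel D', weakPartial (barrel D) i u x * pd j φ x :=
      (weakPartial_spec hu.1 i).2.mono hsub (pd j φ) (hφ.pd j)
    have h2 : ∫ x in barrel D', G x * pd i (pd j φ) x =
        - ∫ x in barrel D', pd i G x * pd j φ x :=
      hasWeakPartial_of_contDiff hG (pd j φ) (hφ.pd j)
    have h3 : ∫ x in barrel D', pd i G x * pd j φ x =
        - ∫ x in barrel D', pd j (pd i G) x * φ x :=
      hasWeakPartial_of_contDiff (hG.pd i) φ hφ
    have h4 := h φ hφ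
    simp only [sub_mul] at h4
    rw [integral_sub (((hφ.pd j).pd i).integrable_mul_restrict (hmono hu.1.1))
      (((hφ.pd j).pd i).integrable_mul_restrict hGm), h1, h2, h3] at h4
    simp only [add_mul]
    rw [integral_add (hφ.integrable_mul_restrict hf) (hφ.integrable_mul_restrict hGij)]
    change ∫ x in barrel D', weakPartial (barrel D) i u x * pd j φ x = _
    linarith
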